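/- Let $\Omega\subset\mathbb R^2$ be a domain, $\vec F=(F_1,F_2)\in C^1(\Omega;\mathbb R^2)$, $H\in C^0(\Omega)$ and $u\in C^1(\Omega)$ with $D:=|\nabla u+\vec F|\neq 0$ everywhere in $\Omega$ ($\Omega$ is nonsingular). Put $N:=(\nabla u+\vec F)/D$, write $(a,b)^\perp:=(b,-a)$ for the rotation by $-\pi/2$, so that $N^\perp$ is $N$ rotated by $-\pi/2$, and $\operatorname{rot}\vec F:=(F_2)_x-(F_1)_y$. Integral curves of $N^\perp$ are called characteristic curves, integral curves of $N$ seed curves; $Nf$ (resp. $N^\perp g$) denotes the derivative of $f$ along seed curves (resp. of $g$ along characteristic curves) with respect to arc length. Suppose that $\operatorname{div}N=H$ in the weak sense: $$\int_\Omega N\cdot\nabla\varphi+\int_\Omega H\varphi=0\qquad\text{for all }\varphi\in C_0^\infty(\Omega).$$ Then for every $p_0\in\Omega$ there exist an open neighborhood $\Omega'\subset\Omega$ of $p_0$ and real functions $s,t\in C^1(\Omega')$ such that the (nonempty) level sets $\{t=\text{const}\}$ and $\{s=\text{const}\}$ in $\Omega'$ are characteristic curves and seed curves, respectively, and there are positive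 functions $f,g\in C^0(\Omega')$ such that $$\nabla s=fN^\perp,\qquad \nabla t=gDN \qquad\text{in }\Omega'.$$ Moreover $Nf$ and $N^\perp g$ exist and are continuous in $\Omega'$, and $$Nf+fH=0,\qquad N^\perp g+\frac{(\operatorname{rot}\vec F)\,g}{D}=0\qquad\text{in }\Omega'.$$ Finally, there is a neighborhood $\Omega''\subset\Omega'$ of $p_0$ such that $\Psi:(x,y)\in\Omega''\mapsto(s,t)\in\Psi(\Omega'')$ is a $C^1$ diffeomorphism with $$\Psi^*\Big(\frac{ds^2}{f^2}+\frac{dt^2}{g^2D^2}\Big)=dx^2+dy^2.$$ -/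

import Mathlib

open Set MeasureTheory
open scoped ContDiff

noncomputable section

namespace PMean

/-- The Euclidean plane with coordinates `x = p 0`, `y = p 1`. -/
abbrev Plane : Type := EuclideanSpace ℝ (Fin 2)

/-- Rotation by `-π/2`: `(a, b) ↦ (b, -a)`. -/
def perp (v : Plane) : Plane := !₂[v 1, -v 0]

/-- `rot F = ∂ₓ F₂ - ∂ᵧ F₁`. -/
def rot (F : Plane → Plane) (p : Plane) : ℝ :=
  fderiv ℝ F p !₂[1, 0] 1 - fderiv ℝ F p !₂[0, 1] 0

/-- The density `D = |∇u + F|`. -/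
def density (u : Plane → ℝ) (F : Plane → Plane) (p : Plane) : ℝ :=
  ‖gradient u p + F p‖

/-- The horizontal normal `N = (∇u + F) / |∇u + F|`. -/
def normal (u : Plane → ℝ) (F : Plane → Plane) (p : Plane) : Plane :=
  (density u F p)⁻¹ • (gradient u p + F p)

/-- The rotated horizontal normal `N^⊥`. -/
def normalPerp (u : Plane → ℝ) (F : Plane → Plane) (p : Plane) : Plane :=
  perp (normal u F p)

/-- The singular set of `u` in `Ω`: the points where `∇u + F = 0`. -/
def singularSet (u : Plane → ℝ) (F : Plane → Plane) (Ω : Set Plane) : Set Plane :=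
  {p ∈ Ω | gradient u p + F p = 0}

/-- `div N = H` on `Ω` in the weak sense: `∫_Ω N · ∇φ + ∫_Ω H φ = 0` for every
`φ ∈ C₀^∞(Ω)`. -/
def DivEqWeakly (N : Plane → Plane) (H : Plane → ℝ) (Ω : Set Plane) : Prop :=
  ∀ φ : Plane → ℝ, ContDiff ℝ ∞ φ → HasCompactSupport φ → tsupport φ ⊆ Ω →
    (∫ p in Ω, inner ℝ (N p) (gradient φ p)) + ∫ p in Ω, H p * φ p = 0

/-- `C` is (the trace of) an integral curve of the vector field `X`, parametrized over a
nonempty open interval. For `X = N^⊥` these are the characteristic curves, for `X = N` the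
seed curves. -/
def IsIntegralCurveTrace (X : Plane → Plane) (C : Set Plane) : Prop :=
  ∃ (I : Set ℝ) (γ : ℝ → Plane), IsOpen I ∧ I.OrdConnected ∧ I.Nonempty ∧
    IsIntegralCurveOn γ (fun _ => X) I ∧ γ '' I = C

/-- The derivative `X h` of `h : U → ℝ` at `p` along the integral curves of `X` in `U` exists
and equals `a`: some integral curve of `X` in `U` passes through `p`, and for each such curve
`γ`, with `γ σ₀ = p`, the function `h ∘ γ` has derivative `a` at `σ₀`. -/
def HasDerivAlong (X : Plane → Plane) (U : Set Plane) (h : Plane → ℝ) (a : ℝ)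
    (p : Plane) : Prop :=
  (∃ C : Set Plane, IsIntegralCurveTrace X C ∧ C ⊆ U ∧ p ∈ C) ∧
  ∀ (I : Set ℝ) (γ : ℝ → Plane), IsOpen I → I.OrdConnected →
    IsIntegralCurveOn γ (fun _ => X) I → MapsTo γ I U →
    ∀ σ₀ ∈ I, γ σ₀ = p → HasDerivAt (fun σ => h (γ σ)) a σ₀

/-- `Ψ` restricts to a `C¹` diffeomorphism of the open set `U` onto the open set `Ψ(U)`, with
inverse `Φ`. -/
def IsC1DiffeoOn (Ψ Φ : Plane → Plane) (U : Set Plane) : Prop :=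
  IsOpen U ∧ IsOpen (Ψ '' U) ∧ ContDiffOn ℝ 1 Ψ U ∧ ContDiffOn ℝ 1 Φ (Ψ '' U) ∧
    LeftInvOn Φ Ψ U

/-- The `i`-th coordinate differential on the plane. -/
def coordDiff (i : Fin 2) : Plane →ₗ[ℝ] ℝ := (EuclideanSpace.proj i : Plane →L[ℝ] ℝ)

/-- The field of bilinear forms `a ds² + b dt²`, `(s, t)` being the standard coordinates of
the target plane. -/
def diagMetric (a b : Plane → ℝ) (q : Plane) : LinearMap.BilinForm ℝ Plane :=
  a q • LinearMap.BilinForm.linMulLin (coordDiff 0) (coordDiff 0) +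
    b q • LinearMap.BilinForm.linMulLin (coordDiff 1) (coordDiff 1)

/-- The Euclidean metric `dx² + dy²`. -/
def euclMetric : Plane → LinearMap.BilinForm ℝ Plane := diagMetric (fun _ => 1) (fun _ => 1)

/-- The pullback `Ψ^* G` of a field of bilinear forms. -/
def pullbackMetric (Ψ : Plane → Plane) (G : Plane → LinearMap.BilinForm ℝ Plane)
    (p : Plane) : LinearMap.BilinForm ℝ Plane :=
  LinearMap.BilinForm.comp (G (Ψ p)) (fderiv ℝ Ψ p : Plane →ₗ[ℝ] Plane)
    (fderiv ℝ Ψ p : Plane →ₗ[ℝ] Plane)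

end PMean

end

/-!
Mollification turns the weak equation `div V = K`, for continuous `V = (a, b)` and `K`, into the
statement that the flux of `V` through the boundary of a rectangle is the integral of `K`. If
`a ≠ 0`, this makes `P = ∫ a dy` a `C¹` function although `b` is merely continuous, and in the
coordinates `(x, P)` the field becomes `a · (1, R)`, where `R` has the continuous derivative `K / a`
in the second variable. The flow of `z' = R(x, z)` is therefore `C¹`, and its derivative in the
initial value yields a positive factor `f` with `f · (a dy - b dx)` exact and `V f = -f K`.

This is applied to `V = N`, `K = H`, and to `V = (∇u + F)^⊥`, `K = rot F`: the circulation of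
`∇u + F` around a rectangle is that of `F`, so no second derivatives of `u` are needed. As `∇s` and
`∇t` are then multiples of the orthonormal frame `(N^⊥, N)`, the coordinates `(s, t)` are
orthogonal.
-/

noncomputable section

namespace PMean

open Filter Topology Metric
open scoped NNReal Convolution

section IntegratingFactor

variable {E E' : Type*} [NormedAddCommGroup E] [NormedSpace ℝ E]
  [NormedAddCommGroup E'] [NormedSpace ℝ E']

/-- `f` has the derivative `f'` along the vector field `V` in `U`. The curves tested are tangent
to `V` but run at an arbitrary speed `c`, so that the notion transforms well under changes of
coordinates. -/
def HasDerivAlongOn (V : E → E) (f f' : E → ℝ) (U : Set E) : Prop :=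
  ∀ (γ : ℝ → E) (c : ℝ → ℝ) (σ : ℝ), γ σ ∈ U →
    (∀ᶠ τ in 𝓝 σ, HasDerivAt γ (c τ • V (γ τ)) τ) →
    HasDerivAt (fun τ => f (γ τ)) (c σ * f' (γ σ)) σ

/-- Near `p` the one-form `α` has a positive integrating factor `f`, that is `f α = ds`, and `f`
has logarithmic derivative `-K` along the vector field `V`. -/
def HasIntegratingFactorAt (α : E → E →L[ℝ] ℝ) (V : E → E) (K : E → ℝ) (p : E) : Prop :=
  ∃ (U : Set E) (s f : E → ℝ), IsOpen U ∧ p ∈ U ∧ ContinuousOn f U ∧ (∀ q ∈ U, 0 < f q) ∧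
    (∀ q ∈ U, HasFDerivAt s (f q • α q) q) ∧ HasDerivAlongOn V f (fun q => -(f q * K q)) U

variable {α : E → E →L[ℝ] ℝ} {V : E → E} {K : E → ℝ} {p : E}

lemma HasIntegratingFactorAt.neg (h : HasIntegratingFactorAt α V K p) :
    HasIntegratingFactorAt (-α) V K p := by
  obtain ⟨U, s, f, hUo, hpU, hf, hf₀, hs, hfV⟩ := h
  refine ⟨U, -s, f, hUo, hpU, hf, hf₀, fun q hq => ?_, hfV⟩
  simpa only [Pi.neg_apply, smul_neg] using (hs q hq).neg

lemma HasIntegratingFactorAt.pullback {α' : E' → E' →L[ℝ] ℝ} {V' : E' → E'} {K' : E' → ℝ}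
    {T : E → E'} {T' : E → E →L[ℝ] E'} {μ : E → ℝ}
    (h : HasIntegratingFactorAt α' V' K' (T p)) (hT : ∀ᶠ q in 𝓝 p, HasFDerivAt T (T' q) q)
    (hα : ∀ᶠ q in 𝓝 p, α q = (α' (T q)).comp (T' q))
    (hV : ∀ᶠ q in 𝓝 p, T' q (V q) = μ q • V' (T q))
    (hK : ∀ᶠ q in 𝓝 p, K q = μ q * K' (T q)) : HasIntegratingFactorAt α V K p := by
  obtain ⟨U, s, f, hUo, hpU, hf, hf₀, hs, hfV⟩ := h
  obtain ⟨W, hW, hWo, hpW⟩ := _root_.eventually_nhds_iff.mp (hT.and (hα.and (hV.and hK)))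
  choose hT hα hV hK using hW
  have hTc : ContinuousOn T W := fun q hq => (hT q hq).continuousAt.continuousWithinAt
  have hUT : MapsTo T (W ∩ T ⁻¹' U) U := fun q hq => hq.2
  refine ⟨W ∩ T ⁻¹' U, s ∘ T, f ∘ T, hTc.isOpen_inter_preimage hWo hUo, ⟨hpW, hpU⟩,
    hf.comp (hTc.mono inter_subset_left) hUT, fun q hq => hf₀ _ hq.2, fun q hq => ?_,
    fun γ c σ hσ hγ => ?_⟩
  · rw [hα q hq.1, ← ContinuousLinearMap.smul_comp]
    exact (hs _ hq.2).comp q (hT q hq.1)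
  · have hγW : ∀ᶠ τ in 𝓝 σ, γ τ ∈ W := hγ.self_of_nhds.continuousAt (hWo.mem_nhds hσ.1)
    have hTγ : ∀ᶠ τ in 𝓝 σ,
        HasDerivAt (T ∘ γ) ((c τ * μ (γ τ)) • V' (T (γ τ))) τ := by
      filter_upwards [hγ, hγW] with τ hτ hτW
      simpa only [map_smul, hV _ hτW, smul_smul] using (hT _ hτW).comp_hasDerivAt τ hτ
    refine (hfV (T ∘ γ) _ σ hσ.2 hTγ).congr_deriv ?_
    simp only [Function.comp_apply, hK _ hσ.1]
    ring

lemma HasIntegratingFactorAt.congr {β : E → E →L[ℝ] ℝ} {W : E → E} {H : E → ℝ}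
    (h : HasIntegratingFactorAt β W H p) (hα : α =ᶠ[𝓝 p] β) (hV : V =ᶠ[𝓝 p] W)
    (hK : K =ᶠ[𝓝 p] H) : HasIntegratingFactorAt α V K p :=
  h.pullback (T := id) (μ := 1) (.of_forall fun q => hasFDerivAt_id q)
    (hα.mono fun q hq => by simp [hq]) (hV.mono fun q hq => by simp [hq])
    (hK.mono fun q hq => by simp [hq])

end IntegratingFactor

section ScalarODE

/-- The model case: in the coordinates given by its flow, a vector field is `∂ₓ`. -/
lemma hasIntegratingFactorAt_exp_integral {κ : ℝ × ℝ → ℝ} (hκ : Continuous κ) (x₀ : ℝ)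
    (p : ℝ × ℝ) :
    HasIntegratingFactorAt
      (fun q => Real.exp (∫ ξ in x₀..q.1, κ (ξ, q.2)) • ContinuousLinearMap.snd ℝ ℝ ℝ)
      (fun _ => (1, 0)) κ p := by
  refine ⟨univ, Prod.snd, fun q => Real.exp (-∫ ξ in x₀..q.1, κ (ξ, q.2)), isOpen_univ,
    mem_univ p, Continuous.continuousOn (by fun_prop), fun q _ => Real.exp_pos _, fun q _ => ?_,
    fun γ c σ _ hγ => ?_⟩
  · rw [smul_smul, ← Real.exp_add, neg_add_cancel, Real.exp_zero, one_smul]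
    exact hasFDerivAt_snd
  · have hγ₂ : ∀ᶠ τ in 𝓝 σ, (γ τ).2 = (γ σ).2 := by
      obtain ⟨ε, hε, h⟩ := eventually_nhds_iff_ball.mp hγ
      filter_upwards [ball_mem_nhds σ hε] with τ hτ
      have hd : ∀ τ ∈ ball σ ε, HasDerivAt (fun τ => (γ τ).2) 0 τ := fun τ hτ =>
        (hasFDerivAt_snd.comp_hasDerivAt τ (h τ hτ)).congr_deriv (by simp)
      exact isOpen_ball.is_const_of_deriv_eq_zero (convex_ball σ ε).isPreconnected
        (fun τ hτ => (hd τ hτ).differentiableAt.differentiableWithinAt)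
        (fun τ hτ => (hd τ hτ).deriv) hτ (mem_ball_self hε)
    have hγ₁ : HasDerivAt (fun τ => (γ τ).1) (c σ) σ :=
      (hasFDerivAt_fst.comp_hasDerivAt σ hγ.self_of_nhds).congr_deriv (by simp)
    have hκσ : Continuous fun ξ => κ (ξ, (γ σ).2) := by fun_prop
    refine (((hκσ.integral_hasStrictDerivAt x₀ (γ σ).1).hasDerivAt.comp σ
      hγ₁).neg.exp.congr_of_eventuallyEq ?_).congr_deriv ?_
    · filter_upwards [hγ₂] with τ hτ
      simp [hτ]
    · simp only [Pi.neg_apply, Function.comp_apply, Prod.mk.eta, mul_neg]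
      ring

end ScalarODE

universe u v

section ContinuousExtension

lemma exists_continuous_eqOn {X : Type u} {Y : Type v} [TopologicalSpace X] [NormalSpace X]
    [TopologicalSpace Y] [TietzeExtension.{u, v} Y] {f : X → Y} {s : Set X}
    (hf : ContinuousOn f s) (hs : IsClosed s) : ∃ g : X → Y, Continuous g ∧ EqOn g f s := by
  obtain ⟨g, hg⟩ := ContinuousMap.exists_restrict_eq hs ⟨s.domRestrict f, hf.domRestrict⟩
  exact ⟨g, g.continuous, fun x hx => congr($hg ⟨x, hx⟩)⟩

lemma exists_continuous_eventuallyEq {X : Type u} {Y : Type v} [PseudoMetricSpace X]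
    [TopologicalSpace Y] [TietzeExtension.{u, v} Y] {f : X → Y} {p : X}
    (hf : ∀ᶠ x in 𝓝 p, ContinuousAt f x) : ∃ g : X → Y, Continuous g ∧ g =ᶠ[𝓝 p] f := by
  obtain ⟨δ, hδ, hs⟩ := nhds_basis_closedBall.eventually_iff.mp hf
  obtain ⟨g, hg, hgf⟩ := exists_continuous_eqOn
    (fun x hx => (hs hx).continuousWithinAt) (isClosed_closedBall (x := p) (ε := δ))
  exact ⟨g, hg, hgf.eventuallyEq_of_mem (closedBall_mem_nhds p hδ)⟩

end ContinuousExtension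

section Flow

/-- For initial values `η` near `z₀`, the functions `Z(·, η)` solve `z' = R(x, z)`,
`z(x₀) = η` near `x₀`; the existence interval has the uniform radius `ε`. -/
structure IsLocalFlow (R Z : ℝ × ℝ → ℝ) (x₀ z₀ ε : ℝ) : Prop where
  continuous : Continuous Z
  initial : ∀ η ∈ ball z₀ ε, Z (x₀, η) = η
  hasDerivAt : ∀ x ∈ ball x₀ ε, ∀ η ∈ ball z₀ ε,
    HasDerivAt (fun x => Z (x, η)) (R (x, Z (x, η))) x

variable {R ρ : ℝ × ℝ → ℝ}

lemma exists_isPicardLindelof (hR : Continuous R) (hρ : Continuous ρ)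
    (hRρ : ∀ x z, HasDerivAt (fun z => R (x, z)) (ρ (x, z)) z) (x₀ z₀ : ℝ) :
    ∃ (ε : ℝ≥0) (L C : ℝ≥0), 0 < ε ∧ ε ≤ 1 / 2 ∧
      IsPicardLindelof (fun x z => R (x, z)) (tmin := x₀ - ε) (tmax := x₀ + ε)
        ⟨x₀, by simp⟩ z₀ 1 (1 / 2) L C := by
  have hcpt : IsCompact (closedBall x₀ 1 ×ˢ closedBall z₀ 1) :=
    (isCompact_closedBall _ _).prod (isCompact_closedBall _ _)
  obtain ⟨L, hL⟩ := hcpt.exists_bound_of_continuousOn hR.continuousOn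
  obtain ⟨C, hC⟩ := hcpt.exists_bound_of_continuousOn hρ.continuousOn
  set ε : ℝ≥0 := 1 / (2 * (L.toNNReal + 1)) with hε
  have hε₁ : ε ≤ 1 / 2 := one_div_le_one_div_of_le two_pos (by simp)
  have hmem : ∀ x ∈ Icc (x₀ - ε) (x₀ + ε), x ∈ closedBall x₀ 1 := fun x hx =>
    closedBall_subset_closedBall (by exact_mod_cast hε₁.trans (by norm_num))
      (Real.closedBall_eq_Icc ▸ hx)
  refine ⟨ε, L.toNNReal, C.toNNReal, by positivity, hε₁, fun x hx => ?_,
    fun z _ => Continuous.continuousOn (by fun_prop), fun x hx z hz => ?_, ?_⟩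
  · refine (convex_closedBall z₀ _).lipschitzOnWith_of_nnnorm_hasDerivWithin_le
      (fun z _ => (hRρ x z).hasDerivWithinAt) fun z hz => ?_
    rw [← NNReal.coe_le_coe, coe_nnnorm]
    exact (hC (x, z) ⟨hmem x hx, by simpa using hz⟩).trans (Real.le_coe_toNNReal _)
  · exact (hL (x, z) ⟨hmem x hx, by simpa using hz⟩).trans (Real.le_coe_toNNReal _)
  · rw [add_sub_cancel_left, sub_sub_cancel, max_self, hε]
    push_cast
    rw [mul_one_div, div_le_iff₀ (by positivity)]
    linarith

lemma exists_isLocalFlow (hR : Continuous R) (hρ : Continuous ρ)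
    (hRρ : ∀ x z, HasDerivAt (fun z => R (x, z)) (ρ (x, z)) z) (x₀ z₀ : ℝ) :
    ∃ ε > 0, ∃ Z, IsLocalFlow R Z x₀ z₀ ε := by
  obtain ⟨ε, L, C, hε, hε₁, hpl⟩ := exists_isPicardLindelof hR hρ hRρ x₀ z₀
  obtain ⟨α, hα, hαc⟩ := hpl.exists_forall_mem_closedBall_eq_hasDerivWithinAt_continuousOn
  obtain ⟨A, hAc, hA⟩ := exists_continuous_eqOn hαc (isClosed_closedBall.prod isClosed_Icc)
  have hη : ∀ η ∈ ball z₀ ε, η ∈ closedBall z₀ ((1 / 2 : ℝ≥0) : ℝ) := fun η hη =>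
    closedBall_subset_closedBall (by exact_mod_cast hε₁) (ball_subset_closedBall hη)
  have hx : ∀ x ∈ ball x₀ (ε : ℝ), x ∈ Icc (x₀ - ε) (x₀ + ε) := fun x hx =>
    Real.closedBall_eq_Icc ▸ ball_subset_closedBall hx
  refine ⟨ε, hε, fun q => A (q.2, q.1), ⟨by fun_prop, fun η h => ?_, fun x h η h' => ?_⟩⟩
  · rw [hA ⟨hη η h, hx x₀ (mem_ball_self hε)⟩, (hα η (hη η h)).1]
  · have hAα : ∀ᶠ y in 𝓝 x, A (η, y) = α (η, y) := by
      filter_upwards [isOpen_ball.mem_nhds h] with y hy using hA ⟨hη η h', hx y hy⟩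
    have hIcc : Icc (x₀ - ε) (x₀ + ε) ∈ 𝓝 x := mem_of_superset (isOpen_ball.mem_nhds h) hx
    simpa only [hAα.self_of_nhds] using
      (((hα η (hη η h')).2 x (hx x h)).hasDerivAt hIcc).congr_of_eventuallyEq hAα

/-- `z₂ - z₁` solves the linear equation whose coefficient is the mean of `ρ` over the segment
from `z₁` to `z₂`. -/
lemma sub_eq_mul_exp_of_hasDerivAt (hρ : Continuous ρ)
    (hRρ : ∀ x z, HasDerivAt (fun z => R (x, z)) (ρ (x, z)) z)
    {x₀ ε : ℝ} {z₁ z₂ : ℝ → ℝ} (hc₁ : Continuous z₁) (hc₂ : Continuous z₂)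
    (hz₁ : ∀ x ∈ ball x₀ ε, HasDerivAt z₁ (R (x, z₁ x)) x)
    (hz₂ : ∀ x ∈ ball x₀ ε, HasDerivAt z₂ (R (x, z₂ x)) x) {x : ℝ} (hx : x ∈ ball x₀ ε) :
    z₂ x - z₁ x = (z₂ x₀ - z₁ x₀) *
      Real.exp (∫ ξ in x₀..x, ∫ τ in (0 : ℝ)..1, ρ (ξ, z₁ ξ + τ * (z₂ ξ - z₁ ξ))) := by
  set m : ℝ → ℝ := fun ξ => ∫ τ in (0 : ℝ)..1, ρ (ξ, z₁ ξ + τ * (z₂ ξ - z₁ ξ)) with hm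
  have hmc : Continuous m := by fun_prop
  have hmR : ∀ ξ, R (ξ, z₂ ξ) - R (ξ, z₁ ξ) = m ξ * (z₂ ξ - z₁ ξ) := fun ξ => by
    have hd : ∀ τ ∈ uIcc (0 : ℝ) 1, HasDerivAt (fun τ => R (ξ, z₁ ξ + τ * (z₂ ξ - z₁ ξ)))
        (ρ (ξ, z₁ ξ + τ * (z₂ ξ - z₁ ξ)) * (z₂ ξ - z₁ ξ)) τ := fun τ _ =>
      ((hRρ ξ _).comp τ (((hasDerivAt_id τ).mul_const _).const_add _)).congr_deriv
        (by rw [one_mul, id])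
    have := intervalIntegral.integral_eq_sub_of_hasDerivAt hd
      (Continuous.intervalIntegrable (by fun_prop) _ _)
    rw [intervalIntegral.integral_mul_const] at this
    simp only [hm, this, one_mul, zero_mul, add_zero, add_sub_cancel]
  have hd : ∀ ξ ∈ ball x₀ ε,
      HasDerivAt (fun ξ => (z₂ ξ - z₁ ξ) * Real.exp (-∫ τ in x₀..ξ, m τ)) 0 ξ := fun ξ hξ => by
    refine (((hz₂ ξ hξ).sub (hz₁ ξ hξ)).mul
      (hmc.integral_hasStrictDerivAt x₀ ξ).hasDerivAt.neg.exp).congr_deriv ?_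
    rw [hmR, Pi.sub_apply]
    ring
  have hconst := isOpen_ball.is_const_of_deriv_eq_zero (convex_ball x₀ ε).isPreconnected
    (fun ξ hξ => (hd ξ hξ).differentiableAt.differentiableWithinAt)
    (fun ξ hξ => (hd ξ hξ).deriv) hx (mem_ball_self (pos_of_mem_ball hx))
  simp only [intervalIntegral.integral_same, neg_zero, Real.exp_zero, mul_one] at hconst
  rw [← hconst, mul_assoc, ← Real.exp_add, neg_add_cancel, Real.exp_zero, mul_one]

lemma IsLocalFlow.hasDerivAt_initial {Z : ℝ × ℝ → ℝ} {x₀ z₀ ε : ℝ}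
    (hZ : IsLocalFlow R Z x₀ z₀ ε) (hρ : Continuous ρ)
    (hRρ : ∀ x z, HasDerivAt (fun z => R (x, z)) (ρ (x, z)) z)
    {x η : ℝ} (hx : x ∈ ball x₀ ε) (hη : η ∈ ball z₀ ε) :
    HasDerivAt (fun η => Z (x, η)) (Real.exp (∫ ξ in x₀..x, ρ (ξ, Z (ξ, η)))) η := by
  have hZc := hZ.continuous
  set e : ℝ → ℝ := fun η' => Real.exp (∫ ξ in x₀..x, ∫ τ in (0 : ℝ)..1,
    ρ (ξ, Z (ξ, η) + τ * (Z (ξ, η') - Z (ξ, η)))) with he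
  have hec : Continuous e := by fun_prop
  have hsub : ∀ η' ∈ ball z₀ ε, Z (x, η') - Z (x, η) = (η' - η) * e η' := fun η' hη' => by
    simpa only [hZ.initial η hη, hZ.initial η' hη'] using
      sub_eq_mul_exp_of_hasDerivAt hρ hRρ (z₁ := fun x => Z (x, η)) (z₂ := fun x => Z (x, η'))
        (by fun_prop) (by fun_prop) (fun x hx => hZ.hasDerivAt x hx η hη)
        (fun x hx => hZ.hasDerivAt x hx η' hη') hx
  have heη : e η = Real.exp (∫ ξ in x₀..x, ρ (ξ, Z (ξ, η))) := by simp [he]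
  rw [← heη, hasDerivAt_iff_tendsto_slope]
  refine (hec.continuousAt.mono_left nhdsWithin_le_nhds).congr' ?_
  filter_upwards [self_mem_nhdsWithin, mem_nhdsWithin_of_mem_nhds (isOpen_ball.mem_nhds hη)]
    with η' hne hη'
  rw [slope_def_field, hsub η' hη', mul_div_cancel_left₀ _ (sub_ne_zero.mpr hne)]

end Flow

section FiberwiseInverse

/-- The linear automorphism `(u, v) ↦ (u, r u + e v)` of `ℝ × ℝ`. -/
def shearEquiv (r e : ℝ) (he : e ≠ 0) : (ℝ × ℝ) ≃L[ℝ] (ℝ × ℝ) :=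
  ContinuousLinearEquiv.equivOfInverse
    ((ContinuousLinearMap.fst ℝ ℝ ℝ).prod
      (r • ContinuousLinearMap.fst ℝ ℝ ℝ + e • ContinuousLinearMap.snd ℝ ℝ ℝ))
    ((ContinuousLinearMap.fst ℝ ℝ ℝ).prod
      (e⁻¹ • (ContinuousLinearMap.snd ℝ ℝ ℝ - r • ContinuousLinearMap.fst ℝ ℝ ℝ)))
    (fun p => by ext <;> simp [he]) (fun p => by ext <;> simp [he])

variable {P P₁ P₂ : ℝ × ℝ → ℝ} {p : ℝ × ℝ}

lemma hasStrictFDerivAt_of_hasDerivAt_partial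
    (h₁ : ∀ᶠ q in 𝓝 p, HasDerivAt (fun x => P (x, q.2)) (P₁ q) q.1)
    (h₂ : ∀ᶠ q in 𝓝 p, HasDerivAt (fun y => P (q.1, y)) (P₂ q) q.2)
    (c₁ : ContinuousAt P₁ p) (c₂ : ContinuousAt P₂ p) :
    HasStrictFDerivAt P
      (P₁ p • ContinuousLinearMap.fst ℝ ℝ ℝ + P₂ p • ContinuousLinearMap.snd ℝ ℝ ℝ) p := by
  have hc : Continuous fun c : ℝ => ContinuousLinearMap.toSpanSingleton ℝ c :=
    (ContinuousLinearMap.toSpanSingletonCLE (𝕜 := ℝ) (E := ℝ)).continuous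
  have := hasStrictFDerivAt_uncurry_coprod (𝕜 := ℝ) (u := p) (f := Function.curry P)
    (f₁ := fun x y => ContinuousLinearMap.toSpanSingleton ℝ (P₁ (x, y)))
    (f₂ := fun x y => ContinuousLinearMap.toSpanSingleton ℝ (P₂ (x, y)))
    (h₁.mono fun q hq => hq.hasFDerivAt) (h₂.mono fun q hq => hq.hasFDerivAt)
    (hc.continuousAt.comp c₁) (hc.continuousAt.comp c₂)
  refine this.congr_fderiv ?_
  ext <;> simp [Function.HasUncurry.uncurry]

lemma exists_fiberwise_inverse
    (h₁ : ∀ᶠ q in 𝓝 p, HasDerivAt (fun x => P (x, q.2)) (P₁ q) q.1)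
    (h₂ : ∀ᶠ q in 𝓝 p, HasDerivAt (fun y => P (q.1, y)) (P₂ q) q.2)
    (c₁ : ∀ᶠ q in 𝓝 p, ContinuousAt P₁ q) (c₂ : ∀ᶠ q in 𝓝 p, ContinuousAt P₂ q)
    (hP₂ : P₂ p ≠ 0) :
    ∃ G : ℝ × ℝ → ℝ, (∀ᶠ q in 𝓝 p, G (q.1, P q) = q.2) ∧
      ∀ᶠ r in 𝓝 (p.1, P p), P (r.1, G r) = r.2 ∧
        HasFDerivAt G ((P₂ (r.1, G r))⁻¹ • (ContinuousLinearMap.snd ℝ ℝ ℝ -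
          P₁ (r.1, G r) • ContinuousLinearMap.fst ℝ ℝ ℝ)) r := by
  set T : ℝ × ℝ → ℝ × ℝ := fun q => (q.1, P q)
  have hTd : ∀ᶠ q in 𝓝 p, ∃ hq : P₂ q ≠ 0, HasStrictFDerivAt T
      (shearEquiv (P₁ q) (P₂ q) hq : (ℝ × ℝ) →L[ℝ] (ℝ × ℝ)) q := by
    filter_upwards [h₁.eventually_nhds, h₂.eventually_nhds, c₁, c₂,
      c₂.self_of_nhds.eventually_ne hP₂] with q h₁ h₂ c₁ c₂ hq
    exact ⟨hq, hasStrictFDerivAt_fst.prodMk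
      (hasStrictFDerivAt_of_hasDerivAt_partial h₁ h₂ c₁ c₂)⟩
  obtain ⟨hp, hTp⟩ := hTd.self_of_nhds
  set e := hTp.toOpenPartialHomeomorph T
  have hpe : p ∈ e.source := hTp.mem_toOpenPartialHomeomorph_source
  have hleft : ∀ᶠ q in 𝓝 p, e.symm (T q) = q := e.eventually_left_inverse hpe
  have hTpe : T p ∈ e.target := e.map_source hpe
  refine ⟨fun r => (e.symm r).2, hleft.mono fun q hq => congr(($hq).2), ?_⟩
  have hsymm : Tendsto e.symm (𝓝 (T p)) (𝓝 p) := by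
    simpa only [hleft.self_of_nhds] using (e.continuousAt_symm hTpe).tendsto
  filter_upwards [e.open_target.mem_nhds hTpe, hsymm.eventually hTd] with r hr ⟨hne, hd⟩
  have hTr : T (e.symm r) = r := e.right_inv hr
  have hr₁ : (e.symm r).1 = r.1 := congr(($hTr).1)
  have hr₂ : (r.1, (e.symm r).2) = e.symm r := Prod.ext hr₁.symm rfl
  rw [hr₂]
  refine ⟨congr(($hTr).2),
    (hasFDerivAt_snd.comp r (e.hasFDerivAt_symm hr hd.hasFDerivAt)).congr_fderiv ?_⟩
  ext <;> simp [shearEquiv]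

end FiberwiseInverse

/-- The one-form `a dy - b dx`, whose integral over a curve is the flux of `(a, b)` across it. -/
def fluxForm (a b : ℝ × ℝ → ℝ) (q : ℝ × ℝ) : ℝ × ℝ →L[ℝ] ℝ :=
  a q • ContinuousLinearMap.snd ℝ ℝ ℝ - b q • ContinuousLinearMap.fst ℝ ℝ ℝ

lemma hasIntegratingFactorAt_of_hasDerivAt_snd {R ρ : ℝ × ℝ → ℝ} (hR : Continuous R)
    (hρ : Continuous ρ) (hRρ : ∀ x z, HasDerivAt (fun z => R (x, z)) (ρ (x, z)) z) (p : ℝ × ℝ) :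
    HasIntegratingFactorAt (fluxForm 1 R) (fun q => (1, R q)) ρ p := by
  obtain ⟨x₀, z₀⟩ := p
  obtain ⟨ε, hε, Z, hZ⟩ := exists_isLocalFlow hR hρ hRρ x₀ z₀
  have hZc := hZ.continuous
  set E : ℝ × ℝ → ℝ := fun q => Real.exp (∫ ξ in x₀..q.1, ρ (ξ, Z (ξ, q.2)))
  have hEc : Continuous E := by fun_prop
  have hRZc : Continuous fun q : ℝ × ℝ => R (q.1, Z q) := by fun_prop
  have hB : ∀ᶠ q : ℝ × ℝ in 𝓝 (x₀, z₀), q.1 ∈ ball x₀ ε ∧ q.2 ∈ ball z₀ ε :=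
    prod_mem_nhds (ball_mem_nhds x₀ hε) (ball_mem_nhds z₀ hε)
  have hZp : Z (x₀, z₀) = z₀ := hZ.initial z₀ (mem_ball_self hε)
  obtain ⟨G, -, hG⟩ := exists_fiberwise_inverse
    (hB.mono fun q hq => hZ.hasDerivAt q.1 hq.1 q.2 hq.2)
    (hB.mono fun q hq => hZ.hasDerivAt_initial hρ hRρ hq.1 hq.2)
    (.of_forall fun q => hRZc.continuousAt) (.of_forall fun q => hEc.continuousAt)
    (Real.exp_ne_zero _)
  simp only [hZp] at hG
  refine (hasIntegratingFactorAt_exp_integral (κ := fun q => ρ (q.1, Z q)) (by fun_prop) x₀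
    (x₀, G (x₀, z₀))).pullback (T := fun q => (q.1, G q)) (μ := 1)
    (hG.mono fun q hq => hasFDerivAt_fst.prodMk hq.2) ?_ ?_ ?_
  all_goals filter_upwards [hG] with q hq
  · ext <;> simp [fluxForm, hq.1]
  · simp [hq.1]
  · simp [hq.1]

/-- The flux of `(a, b)` through the boundary of each rectangle in `U` is the integral of `K`. -/
def HasFluxDensityOn (a b K : ℝ × ℝ → ℝ) (U : Set (ℝ × ℝ)) : Prop :=
  ∀ x₁ x₂ y₁ y₂ : ℝ, uIcc x₁ x₂ ×ˢ uIcc y₁ y₂ ⊆ U →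
    (∫ y in y₁..y₂, (a (x₂, y) - a (x₁, y))) + (∫ x in x₁..x₂, (b (x, y₂) - b (x, y₁))) =
      ∫ x in x₁..x₂, ∫ y in y₁..y₂, K (x, y)

lemma HasFluxDensityOn.mono {a b K : ℝ × ℝ → ℝ} {U U' : Set (ℝ × ℝ)}
    (h : HasFluxDensityOn a b K U) (hU : U' ⊆ U) : HasFluxDensityOn a b K U' :=
  fun x₁ x₂ y₁ y₂ hsub => h x₁ x₂ y₁ y₂ (hsub.trans hU)

section Flux

variable {a b K : ℝ × ℝ → ℝ} {U : Set (ℝ × ℝ)} {x₀ y₀ r : ℝ}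

lemma HasFluxDensityOn.hasDerivAt_integral_snd (ha : Continuous a) (hb : Continuous b)
    (hK : Continuous K) (h : HasFluxDensityOn a b K (ball x₀ r ×ˢ ball y₀ r)) {x y : ℝ}
    (hx : x ∈ ball x₀ r) (hy : y ∈ ball y₀ r) :
    HasDerivAt (fun x => ∫ η in y₀..y, a (x, η))
      (b (x, y₀) - b (x, y) + ∫ η in y₀..y, K (x, η)) x := by
  have hd : HasDerivAt (fun x => (∫ η in y₀..y, a (x₀, η)) +
      ∫ ξ in x₀..x, (b (ξ, y₀) - b (ξ, y) + ∫ η in y₀..y, K (ξ, η)))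
      (b (x, y₀) - b (x, y) + ∫ η in y₀..y, K (x, η)) x :=
    (Continuous.integral_hasStrictDerivAt (by fun_prop) x₀ x).hasDerivAt.const_add _
  refine hd.congr_of_eventuallyEq ?_
  filter_upwards [isOpen_ball.mem_nhds hx] with x hx
  have hsub : uIcc x₀ x ×ˢ uIcc y₀ y ⊆ ball x₀ r ×ˢ ball y₀ r :=
    prod_mono ((convex_ball x₀ r).ordConnected.uIcc_subset (mem_ball_self (pos_of_mem_ball hx)) hx)
      ((convex_ball y₀ r).ordConnected.uIcc_subset (mem_ball_self (pos_of_mem_ball hx)) hy)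
  have hflux := h x₀ x y₀ y hsub
  have hi : ∀ {f : ℝ → ℝ} {u v : ℝ}, Continuous f → IntervalIntegrable f volume u v :=
    fun hf => hf.intervalIntegrable _ _
  rw [intervalIntegral.integral_sub (hi (by fun_prop)) (hi (by fun_prop)),
    intervalIntegral.integral_sub (hi (by fun_prop)) (hi (by fun_prop))] at hflux
  rw [intervalIntegral.integral_add (hi (by fun_prop)) (hi (by fun_prop)),
    intervalIntegral.integral_sub (hi (by fun_prop)) (hi (by fun_prop))]
  linarith

lemma HasFluxDensityOn.exists_continuous_comp_mul_eq (ha : Continuous a) (hb : Continuous b)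
    (hK : Continuous K) (h : HasFluxDensityOn a b K (ball x₀ r ×ˢ ball y₀ r)) (hr : 0 < r)
    (ha₀ : a (x₀, y₀) ≠ 0) :
    ∃ ρ : ℝ × ℝ → ℝ, Continuous ρ ∧
      ∀ᶠ q in 𝓝 (x₀, y₀), ρ (q.1, ∫ η in y₀..q.2, a (q.1, η)) * a q = K q := by
  set P : ℝ × ℝ → ℝ := fun q => ∫ η in y₀..q.2, a (q.1, η) with hP
  have hPc : Continuous P := by fun_prop
  have hB : ∀ᶠ q : ℝ × ℝ in 𝓝 (x₀, y₀), q.1 ∈ ball x₀ r ∧ q.2 ∈ ball y₀ r :=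
    prod_mem_nhds (ball_mem_nhds x₀ hr) (ball_mem_nhds y₀ hr)
  obtain ⟨G, hGP, hG⟩ := exists_fiberwise_inverse (P := P) (P₂ := a)
    (P₁ := fun q => b (q.1, y₀) - b q + ∫ η in y₀..q.2, K (q.1, η))
    (hB.mono fun q hq => h.hasDerivAt_integral_snd ha hb hK hq.1 hq.2)
    (.of_forall fun q => (Continuous.integral_hasStrictDerivAt
      (f := fun η => a (q.1, η)) (by fun_prop) y₀ q.2).hasDerivAt)
    (.of_forall fun q => Continuous.continuousAt (by fun_prop))
    (.of_forall fun q => ha.continuousAt) ha₀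
  have hGc : ∀ᶠ r in 𝓝 (x₀, P (x₀, y₀)), ContinuousAt G r := hG.mono fun r hr => hr.2.continuousAt
  have hG₀ : G (x₀, P (x₀, y₀)) = y₀ := hGP.self_of_nhds
  have haG : ∀ᶠ r in 𝓝 (x₀, P (x₀, y₀)), a (r.1, G r) ≠ 0 := by
    have : ContinuousAt (fun r => a (r.1, G r)) (x₀, P (x₀, y₀)) :=
      ha.continuousAt.comp (continuousAt_fst.prodMk hGc.self_of_nhds)
    exact this.eventually_ne (by simpa only [hG₀] using ha₀)
  obtain ⟨ρ, hρ, hρG⟩ := exists_continuous_eventuallyEq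
    (f := fun r => K (r.1, G r) / a (r.1, G r)) (p := (x₀, P (x₀, y₀))) <| by
      filter_upwards [hGc, haG] with r hr hne
      exact ContinuousAt.div (by fun_prop) (by fun_prop) hne
  have hQ : ContinuousAt (fun q => (q.1, P q)) (x₀, y₀) := by fun_prop
  refine ⟨ρ, hρ, ?_⟩
  filter_upwards [hGP, hQ.eventually hρG, ha.continuousAt.eventually_ne ha₀] with q hq hq' hne
  simp only [hP] at hq hq'
  simp only [hq', hq, Prod.mk.eta, div_mul_cancel₀ _ hne]

lemma eventually_integral_eq_integral_of_comp_mul_eq {ρ : ℝ × ℝ → ℝ} (ha : Continuous a)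
    (hρ : Continuous ρ)
    (hρK : ∀ᶠ q in 𝓝 (x₀, y₀), ρ (q.1, ∫ η in y₀..q.2, a (q.1, η)) * a q = K q) :
    ∀ᶠ q in 𝓝 (x₀, y₀), ∫ ζ in (0 : ℝ)..(∫ η in y₀..q.2, a (q.1, η)), ρ (q.1, ζ) =
      ∫ η in y₀..q.2, K (q.1, η) := by
  obtain ⟨δ, hδ, hδρ⟩ := eventually_nhds_iff_ball.mp hρK
  filter_upwards [ball_mem_nhds _ hδ] with q hq
  set P : ℝ → ℝ := fun y => ∫ η in y₀..y, a (q.1, η) with hP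
  have hPd : ∀ y, HasDerivAt P (a (q.1, y)) y := fun y =>
    (Continuous.integral_hasStrictDerivAt (by fun_prop) y₀ y).hasDerivAt
  have hK : ∀ η ∈ uIcc y₀ q.2, ρ (q.1, P η) * a (q.1, η) = K (q.1, η) := fun η hη => by
    have hη' : dist η y₀ ≤ dist q.2 y₀ := by
      simpa only [dist_comm _ y₀] using Real.dist_left_le_of_mem_uIcc hη
    exact hδρ (q.1, η) ((max_le_max le_rfl hη').trans_lt hq)
  calc ∫ ζ in (0 : ℝ)..P q.2, ρ (q.1, ζ)
    _ = ∫ ζ in P y₀..P q.2, ρ (q.1, ζ) := by simp [hP]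
    _ = ∫ η in y₀..q.2, ρ (q.1, P η) * a (q.1, η) :=
      (intervalIntegral.integral_comp_mul_deriv (g := fun ζ => ρ (q.1, ζ)) (fun η _ => hPd η)
        (Continuous.continuousOn (by fun_prop)) (by fun_prop)).symm
    _ = ∫ η in y₀..q.2, K (q.1, η) := intervalIntegral.integral_congr hK

lemma HasFluxDensityOn.hasIntegratingFactorAt_of_fst_ne_zero (ha : Continuous a)
    (hb : Continuous b) (hK : Continuous K)
    (h : HasFluxDensityOn a b K (ball x₀ r ×ˢ ball y₀ r)) (hr : 0 < r) (ha₀ : a (x₀, y₀) ≠ 0) :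
    HasIntegratingFactorAt (fluxForm a b) (fun q => (a q, b q)) K (x₀, y₀) := by
  obtain ⟨ρ, hρ, hρK⟩ := h.exists_continuous_comp_mul_eq ha hb hK hr ha₀
  set P : ℝ × ℝ → ℝ := fun q => ∫ η in y₀..q.2, a (q.1, η) with hP
  set P₁ : ℝ × ℝ → ℝ := fun q => b (q.1, y₀) - b q + ∫ η in y₀..q.2, K (q.1, η) with hP₁
  -- `R` is `dP/dx` along the curves of `(a, b)`, written as a function of `(x, P)`.
  set R : ℝ × ℝ → ℝ := fun r => b (r.1, y₀) + ∫ ζ in (0 : ℝ)..r.2, ρ (r.1, ζ) with hR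
  have hRρ : ∀ x z, HasDerivAt (fun z => R (x, z)) (ρ (x, z)) z := fun x z =>
    (Continuous.integral_hasStrictDerivAt (f := fun ζ => ρ (x, ζ)) (by fun_prop) 0
      z).hasDerivAt.const_add (b (x, y₀))
  have hB : ∀ᶠ q : ℝ × ℝ in 𝓝 (x₀, y₀), q.1 ∈ ball x₀ r ∧ q.2 ∈ ball y₀ r :=
    prod_mem_nhds (ball_mem_nhds x₀ hr) (ball_mem_nhds y₀ hr)
  have hPy : ∀ x y, HasDerivAt (fun y => P (x, y)) (a (x, y)) y := fun x y =>
    (Continuous.integral_hasStrictDerivAt (f := fun η => a (x, η)) (by fun_prop) y₀ y).hasDerivAt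
  have hRP : ∀ᶠ q in 𝓝 (x₀, y₀), R (q.1, P q) = P₁ q + b q := by
    filter_upwards [eventually_integral_eq_integral_of_comp_mul_eq ha hρ hρK] with q hq
    simp only [hR, hP₁, hP, hq]
    ring
  refine (hasIntegratingFactorAt_of_hasDerivAt_snd (by fun_prop) hρ hRρ (x₀, P (x₀, y₀))).pullback
    (T := fun q => (q.1, P q)) (μ := a)
    (T' := fun q => (ContinuousLinearMap.fst ℝ ℝ ℝ).prod
      (P₁ q • ContinuousLinearMap.fst ℝ ℝ ℝ + a q • ContinuousLinearMap.snd ℝ ℝ ℝ)) ?_ ?_ ?_ ?_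
  · filter_upwards [hB.eventually_nhds] with q hq
    refine hasFDerivAt_fst.prodMk (hasStrictFDerivAt_of_hasDerivAt_partial
      (hq.mono fun q hq => h.hasDerivAt_integral_snd ha hb hK hq.1 hq.2)
      (.of_forall fun q => hPy q.1 q.2) ?_ ha.continuousAt).hasFDerivAt
    exact Continuous.continuousAt (by fun_prop)
  · filter_upwards [hRP] with q hq
    ext <;> simp [fluxForm, hq]
  · filter_upwards [hRP] with q hq
    ext <;> simp only [ContinuousLinearMap.prod_apply, ContinuousLinearMap.coe_fst',
      ContinuousLinearMap.coe_snd', add_apply, smul_apply, smul_eq_mul, hq, Prod.smul_mk, mul_one]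
    ring
  · filter_upwards [hρK] with q hq
    rw [← hq, mul_comm]

lemma HasFluxDensityOn.swap (hK : Continuous K)
    (h : HasFluxDensityOn a b K U) :
    HasFluxDensityOn (b ∘ Prod.swap) (a ∘ Prod.swap) (K ∘ Prod.swap) (Prod.swap ⁻¹' U) := by
  intro x₁ x₂ y₁ y₂ hsub
  have hsub' : uIcc y₁ y₂ ×ˢ uIcc x₁ x₂ ⊆ U := fun q hq => @hsub q.swap ⟨hq.2, hq.1⟩
  simp only [Function.comp_apply, Prod.swap_prod_mk]
  rw [add_comm, h y₁ y₂ x₁ x₂ hsub']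
  exact intervalIntegral_intervalIntegral_swap ((hK.continuousOn.integrableOn_compact
    (isCompact_uIcc.prod isCompact_uIcc)).mono_set (prod_mono uIoc_subset_uIcc uIoc_subset_uIcc))

theorem HasFluxDensityOn.hasIntegratingFactorAt {p : ℝ × ℝ} (ha : Continuous a)
    (hb : Continuous b) (hK : Continuous K) (h : HasFluxDensityOn a b K U) (hU : U ∈ 𝓝 p)
    (hp : a p ≠ 0 ∨ b p ≠ 0) :
    HasIntegratingFactorAt (fluxForm a b) (fun q => (a q, b q)) K p := by
  obtain ⟨r, hr, hrU⟩ := Metric.mem_nhds_iff.mp hU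
  have hr' := h.mono ((ball_prod_same p.1 p.2 r).trans_subset hrU)
  rcases hp with ha₀ | hb₀
  · exact hr'.hasIntegratingFactorAt_of_fst_ne_zero ha hb hK hr ha₀
  · have hswap := hr'.swap hK
    rw [preimage_swap_prod] at hswap
    refine (hswap.hasIntegratingFactorAt_of_fst_ne_zero (by fun_prop) (by fun_prop)
      (by fun_prop) hr hb₀).neg.pullback (T := Prod.swap) (p := p) (μ := 1)
      (T' := fun _ => (ContinuousLinearEquiv.prodComm ℝ ℝ ℝ : ℝ × ℝ →L[ℝ] ℝ × ℝ))
      (.of_forall fun q => (ContinuousLinearEquiv.prodComm ℝ ℝ ℝ).hasFDerivAt)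
      (.of_forall fun q => ?_) (.of_forall fun q => ?_) (.of_forall fun q => ?_)
    · ext <;> simp [fluxForm]
    · simp
    · simp

end Flux

section WeakDivergence

variable {V W : Plane → Plane} {H K : Plane → ℝ} {U Ω : Set Plane}

lemma gradient_of_notMem_tsupport {E : Type*} [NormedAddCommGroup E] [InnerProductSpace ℝ E]
    [CompleteSpace E] {φ : E → ℝ} {q : E} (hq : q ∉ tsupport φ) :
    gradient φ q = 0 := by
  rw [gradient, fderiv_of_notMem_tsupport ℝ hq, map_zero]

lemma divEqWeakly_iff_integral : DivEqWeakly V K U ↔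
    ∀ φ : Plane → ℝ, ContDiff ℝ ∞ φ → HasCompactSupport φ → tsupport φ ⊆ U →
      (∫ p, inner ℝ (V p) (gradient φ p)) + ∫ p, K p * φ p = 0 := by
  refine forall₄_congr fun φ _ _ hφU => ?_
  rw [setIntegral_eq_integral_of_forall_compl_eq_zero fun q hq => by
      rw [gradient_of_notMem_tsupport (notMem_subset hφU hq), inner_zero_right],
    setIntegral_eq_integral_of_forall_compl_eq_zero fun q hq => by
      rw [image_eq_zero_of_notMem_tsupport (notMem_subset hφU hq), mul_zero]]

lemma DivEqWeakly.mono (h : DivEqWeakly V K Ω) (hU : U ⊆ Ω) : DivEqWeakly V K U :=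
  divEqWeakly_iff_integral.mpr fun φ hφ hφc hφU =>
    divEqWeakly_iff_integral.mp h φ hφ hφc (hφU.trans hU)

lemma DivEqWeakly.congr (h : DivEqWeakly V K U) (hU : MeasurableSet U) (hVW : EqOn V W U)
    (hKH : EqOn K H U) : DivEqWeakly W H U := by
  intro φ hφ hφc hφU
  rw [← h φ hφ hφc hφU]
  congr 1
  · exact setIntegral_congr_fun hU fun q hq => by simp only [hVW hq]
  · exact setIntegral_congr_fun hU fun q hq => by simp only [hKH hq]

/-- The mollification of `k` with the bump function `φ`. -/
def mollify (φ : ContDiffBump (0 : Plane)) (k : Plane → ℝ) : Plane → ℝ :=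
  k ⋆[ContinuousLinearMap.lsmul ℝ ℝ, volume] φ.normed volume

variable {k : Plane → ℝ} {φ : ContDiffBump (0 : Plane)}

lemma contDiff_mollify (hk : Continuous k) : ContDiff ℝ ∞ (mollify φ k) :=
  φ.hasCompactSupport_normed.contDiff_convolution_right _ hk.locallyIntegrable φ.contDiff_normed

lemma fderiv_mollify_apply (hk : Continuous k) (p v : Plane) :
    fderiv ℝ (mollify φ k) p v = ∫ q, k q * fderiv ℝ (φ.normed volume) (p - q) v := by
  rw [mollify, (φ.hasCompactSupport_normed.hasFDerivAt_convolution_right _ hk.locallyIntegrable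
    φ.contDiff_normed p).fderiv, convolution_precompR_apply _ hk.locallyIntegrable
    (φ.hasCompactSupport_normed.fderiv ℝ) (φ.contDiff_normed.continuous_fderiv one_ne_zero)]
  simp [convolution_def]

lemma tendsto_mollify {ι : Type*} {l : Filter ι} {φ : ι → ContDiffBump (0 : Plane)}
    (hk : Continuous k) (hφ : Tendsto (fun i => (φ i).rOut) l (𝓝 0)) :
    Tendsto (fun i => (⟨mollify (φ i) k, (contDiff_mollify hk).continuous⟩ : C(Plane, ℝ))) l
      (𝓝 ⟨k, hk⟩) := by
  have hflip : (ContinuousLinearMap.lsmul ℝ ℝ : ℝ →L[ℝ] ℝ →L[ℝ] ℝ).flip =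
      ContinuousLinearMap.lsmul ℝ ℝ := by ext; simp
  rw [ContinuousMap.tendsto_iff_tendstoLocallyUniformly,
    tendstoLocallyUniformly_iff_forall_tendsto]
  intro p
  refine (Tendsto.prodMk_nhds ?_ ?_).mono_right (nhds_le_uniformity (k p))
  · exact hk.continuousAt.tendsto.comp tendsto_snd
  · simp only [ContinuousMap.coe_mk, mollify]
    rw [← hflip]
    simp only [convolution_flip]
    exact ContDiffBump.convolution_tendsto_right (hφ.comp tendsto_fst)
      (.of_forall fun _ => hk.aestronglyMeasurable) (hk.continuousAt.tendsto.comp tendsto_snd)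
      tendsto_snd

lemma integrable_mul_fderiv_normed (hk : Continuous k) (p v : Plane) :
    Integrable fun q => k q * fderiv ℝ (φ.normed volume) (p - q) v := by
  refine Continuous.integrable_of_hasCompactSupport ?_ ?_
  · have := (φ.contDiff_normed (μ := volume) (n := 1)).continuous_fderiv one_ne_zero
    fun_prop
  · exact ((φ.hasCompactSupport_normed.fderiv_apply ℝ v).comp_homeomorph
      (Homeomorph.subLeft p)).mul_left

lemma gradient_comp_const_sub {E : Type*} [NormedAddCommGroup E] [InnerProductSpace ℝ E]
    [CompleteSpace E] {f : E → ℝ} {p q : E} (hf : DifferentiableAt ℝ f (p - q)) :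
    gradient (fun q => f (p - q)) q = -gradient f (p - q) := by
  refine HasGradientAt.gradient (hasGradientAt_iff_hasFDerivAt.mpr ?_)
  refine (hf.hasGradientAt.hasFDerivAt.comp q ((hasFDerivAt_id q).const_sub p)).congr_fderiv ?_
  ext
  simp

lemma DivEqWeakly.sum_fderiv_mollify (h : DivEqWeakly V K U) (hV : Continuous V) {p : Plane}
    (hp : closedBall p φ.rOut ⊆ U) :
    ∑ i, fderiv ℝ (mollify φ fun q => V q i) p (EuclideanSpace.single i 1) = mollify φ K p := by
  set ψ : Plane → ℝ := fun q => φ.normed volume (p - q) with hψ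
  have hψs : tsupport ψ ⊆ closedBall p φ.rOut := by
    refine closure_minimal (fun q hq => ?_) isClosed_closedBall
    have hq' : p - q ∈ tsupport (φ.normed volume) := subset_tsupport _ hq
    rwa [φ.tsupport_normed_eq, mem_closedBall_zero_iff, ← mem_closedBall_iff_norm'] at hq'
  have hweak := divEqWeakly_iff_integral.mp h ψ
    (φ.contDiff_normed.comp (contDiff_const.sub contDiff_id))
    ((isCompact_closedBall p φ.rOut).of_isClosed_subset (isClosed_tsupport ψ) hψs) (hψs.trans hp)
  have hψ' : ∀ q, inner ℝ (V q) (gradient ψ q) =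
      -∑ i, V q i * fderiv ℝ (φ.normed volume) (p - q) (EuclideanSpace.single i 1) := fun q => by
    rw [hψ, gradient_comp_const_sub (φ.contDiff_normed.differentiable one_ne_zero _),
      inner_neg_right, PiLp.inner_apply]
    simp [← inner_gradient_left, EuclideanSpace.inner_single_right, mul_comm]
  simp only [hψ', integral_neg] at hweak
  calc ∑ i, fderiv ℝ (mollify φ fun q => V q i) p (EuclideanSpace.single i 1)
    _ = ∑ i, ∫ q, V q i * fderiv ℝ (φ.normed volume) (p - q) (EuclideanSpace.single i 1) :=
      Finset.sum_congr rfl fun i _ => fderiv_mollify_apply (by fun_prop) p _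
    _ = ∫ q, K q * ψ q := by
      rw [← integral_finsetSum _ fun i _ => integrable_mul_fderiv_normed (by fun_prop) p _]
      linarith
    _ = mollify φ K p := by simp [mollify, convolution_def, hψ]

end WeakDivergence

/-- The identification of the plane with `ℝ × ℝ`. -/
def toPlane : (ℝ × ℝ) ≃L[ℝ] Plane :=
  (ContinuousLinearEquiv.finTwoArrow ℝ ℝ).symm.trans (EuclideanSpace.equiv (Fin 2) ℝ).symm

@[simp] lemma toPlane_apply_zero (q : ℝ × ℝ) : toPlane q 0 = q.1 := rfl
@[simp] lemma toPlane_apply_one (q : ℝ × ℝ) : toPlane q 1 = q.2 := rfl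

lemma toPlane_one_zero : toPlane (1, 0) = EuclideanSpace.single 0 1 := by
  ext i; fin_cases i <;> simp

lemma toPlane_zero_one : toPlane (0, 1) = EuclideanSpace.single 1 1 := by
  ext i; fin_cases i <;> simp

lemma hasFluxDensityOn_of_hasFDerivAt {a b K : ℝ × ℝ → ℝ} {a' b' : ℝ × ℝ → ℝ × ℝ →L[ℝ] ℝ}
    {U : Set (ℝ × ℝ)} (ha : ∀ q ∈ U, HasFDerivAt a (a' q) q)
    (hb : ∀ q ∈ U, HasFDerivAt b (b' q) q) (hK : ContinuousOn K U)
    (hdiv : ∀ q ∈ U, a' q (1, 0) + b' q (0, 1) = K q) : HasFluxDensityOn a b K U := by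
  intro x₁ x₂ y₁ y₂ hU
  have hIoo : Ioo (min x₁ x₂) (max x₁ x₂) ×ˢ Ioo (min y₁ y₂) (max y₁ y₂) ⊆ U :=
    (Set.prod_mono Ioo_subset_Icc_self Ioo_subset_Icc_self).trans hU
  have hac : ContinuousOn a U := fun q hq => (ha q hq).continuousAt.continuousWithinAt
  have hbc : ContinuousOn b U := fun q hq => (hb q hq).continuousAt.continuousWithinAt
  have hx : ∀ x ∈ uIcc x₁ x₂, IntervalIntegrable (fun y => a (x, y)) volume y₁ y₂ := fun x hx =>
    (hac.comp (by fun_prop) fun y hy => hU ⟨hx, hy⟩).intervalIntegrable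
  have hy : ∀ y ∈ uIcc y₁ y₂, IntervalIntegrable (fun x => b (x, y)) volume x₁ x₂ := fun y hy =>
    (hbc.comp (f := fun x => (x, y)) (by fun_prop) fun x hx => hU ⟨hx, hy⟩).intervalIntegrable
  have hint : IntegrableOn (fun q => a' q (1, 0) + b' q (0, 1)) (uIcc x₁ x₂ ×ˢ uIcc y₁ y₂) :=
    ((hK.congr hdiv).mono hU).integrableOn_compact (isCompact_uIcc.prod isCompact_uIcc)
  calc (∫ y in y₁..y₂, (a (x₂, y) - a (x₁, y))) + (∫ x in x₁..x₂, (b (x, y₂) - b (x, y₁)))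
    _ = ∫ x in x₁..x₂, ∫ y in y₁..y₂, (a' (x, y) (1, 0) + b' (x, y) (0, 1)) := by
      rw [integral2_divergence_prod_of_hasFDerivAt a b a' b' x₁ y₁ x₂ y₂ (hac.mono hU)
        (hbc.mono hU) (fun q hq => ha q (hIoo hq)) (fun q hq => hb q (hIoo hq)) hint,
        intervalIntegral.integral_sub (hx _ right_mem_uIcc) (hx _ left_mem_uIcc),
        intervalIntegral.integral_sub (hy _ right_mem_uIcc) (hy _ left_mem_uIcc)]
      ring
    _ = ∫ x in x₁..x₂, ∫ y in y₁..y₂, K (x, y) :=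
      intervalIntegral.integral_congr fun x hx => intervalIntegral.integral_congr fun y hy =>
        hdiv (x, y) (hU ⟨hx, hy⟩)

lemma DivEqWeakly.hasFluxDensityOn_mollify {V : Plane → Plane} {K : Plane → ℝ} {U : Set Plane}
    (h : DivEqWeakly V K U) (hV : Continuous V) (hK : Continuous K)
    (φ : ContDiffBump (0 : Plane)) :
    HasFluxDensityOn (fun q => mollify φ (fun p => V p 0) (toPlane q))
      (fun q => mollify φ (fun p => V p 1) (toPlane q)) (fun q => mollify φ K (toPlane q))
      {q | closedBall (toPlane q) φ.rOut ⊆ U} := by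
  have hd : ∀ i q, HasFDerivAt (fun q => mollify φ (fun p => V p i) (toPlane q))
      ((fderiv ℝ (mollify φ fun p => V p i) (toPlane q)).comp (toPlane : ℝ × ℝ →L[ℝ] Plane)) q :=
    fun i q => ((contDiff_mollify (by fun_prop)).differentiable (by simp)
      _).hasFDerivAt.comp q toPlane.hasFDerivAt
  refine hasFluxDensityOn_of_hasFDerivAt (fun q _ => hd 0 q) (fun q _ => hd 1 q)
    ((contDiff_mollify hK).continuous.comp toPlane.continuous).continuousOn fun q hq => ?_
  rw [← h.sum_fderiv_mollify hV hq, Fin.sum_univ_two, ← toPlane_one_zero, ← toPlane_zero_one]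
  rfl

/-- `div V = K` on `U` in integrated form: the flux of `V` through the boundary of each coordinate
rectangle in `U` is the integral of `K`. -/
def HasDivergenceOn (V : Plane → Plane) (K : Plane → ℝ) (U : Set Plane) : Prop :=
  HasFluxDensityOn (fun q => V (toPlane q) 0) (fun q => V (toPlane q) 1)
    (fun q => K (toPlane q)) (toPlane ⁻¹' U)

lemma DivEqWeakly.hasDivergenceOn_of_continuous {V : Plane → Plane} {K : Plane → ℝ} {U : Set Plane}
    (h : DivEqWeakly V K U) (hU : IsOpen U) (hV : Continuous V) (hK : Continuous K) :
    HasDivergenceOn V K U := by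
  intro x₁ x₂ y₁ y₂ hQ
  have hVc : ∀ i, Continuous fun p => V p i := fun i => by fun_prop
  obtain ⟨δ, hδ, hδU⟩ := ((isCompact_uIcc.prod isCompact_uIcc).image
    toPlane.continuous).exists_cthickening_subset_open hU (image_subset_iff.mpr hQ)
  set φ : ℕ → ContDiffBump (0 : Plane) := fun n =>
    ⟨1 / (n + 1) / 2, 1 / (n + 1), by positivity, half_lt_self (by positivity)⟩
  have hφ₀ : Tendsto (fun n => (φ n).rOut) atTop (𝓝 0) := tendsto_one_div_add_atTop_nhds_zero_nat
  have hlim := (tendsto_mollify (hVc 0) hφ₀).prodMk_nhds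
    ((tendsto_mollify (hVc 1) hφ₀).prodMk_nhds (tendsto_mollify hK hφ₀))
  have hcont : Continuous fun k : C(Plane, ℝ) × C(Plane, ℝ) × C(Plane, ℝ) =>
      (∫ y in y₁..y₂, (k.1 (toPlane (x₂, y)) - k.1 (toPlane (x₁, y)))) +
      (∫ x in x₁..x₂, (k.2.1 (toPlane (x, y₂)) - k.2.1 (toPlane (x, y₁)))) -
      ∫ x in x₁..x₂, ∫ y in y₁..y₂, k.2.2 (toPlane (x, y)) := by fun_prop
  refine sub_eq_zero.mp (tendsto_nhds_unique ((hcont.tendsto _).comp hlim)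
    (tendsto_const_nhds.congr' ?_))
  filter_upwards [hφ₀.eventually_lt_const hδ] with n hn
  refine (sub_eq_zero.mpr (h.hasFluxDensityOn_mollify hV hK (φ n) x₁ x₂ y₁ y₂
    fun q hq => ?_)).symm
  exact (closedBall_subset_cthickening (mem_image_of_mem toPlane hq) _).trans
    ((cthickening_mono hn.le _).trans hδU)

section Divergence

variable {V W : Plane → Plane} {H K : Plane → ℝ} {U Ω : Set Plane} {p : Plane}

lemma HasDivergenceOn.mono_congr (h : HasDivergenceOn V K Ω) (hU : U ⊆ Ω) (hVW : EqOn V W U)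
    (hKH : EqOn K H U) : HasDivergenceOn W H U := by
  intro x₁ x₂ y₁ y₂ hQ
  have hQ' : ∀ x ∈ uIcc x₁ x₂, ∀ y ∈ uIcc y₁ y₂, toPlane (x, y) ∈ U := fun x hx y hy => hQ ⟨hx, hy⟩
  rw [← intervalIntegral.integral_congr fun x hx => intervalIntegral.integral_congr fun y hy =>
    hKH (hQ' x hx y hy), ← h x₁ x₂ y₁ y₂ fun q hq => hU (hQ hq)]
  congr 1
  · refine intervalIntegral.integral_congr fun y hy => ?_
    simp only [hVW (hQ' _ left_mem_uIcc y hy), hVW (hQ' _ right_mem_uIcc y hy)]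
  · refine intervalIntegral.integral_congr fun x hx => ?_
    simp only [hVW (hQ' x hx _ left_mem_uIcc), hVW (hQ' x hx _ right_mem_uIcc)]

lemma HasFluxDensityOn.add_solenoidal {a b a₀ b₀ K : ℝ × ℝ → ℝ} {U : Set (ℝ × ℝ)}
    (h : HasFluxDensityOn a b K U) (h₀ : HasFluxDensityOn a₀ b₀ 0 U) (ha : ContinuousOn a U)
    (hb : ContinuousOn b U) (ha₀ : ContinuousOn a₀ U) (hb₀ : ContinuousOn b₀ U) :
    HasFluxDensityOn (a + a₀) (b + b₀) K U := by
  intro x₁ x₂ y₁ y₂ hQ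
  have hx : ∀ {f : ℝ × ℝ → ℝ}, ContinuousOn f U → ∀ x ∈ uIcc x₁ x₂,
      IntervalIntegrable (fun y => f (x, y)) volume y₁ y₂ := fun hf x hx =>
    (hf.comp (by fun_prop) fun y hy => hQ ⟨hx, hy⟩).intervalIntegrable
  have hy : ∀ {f : ℝ × ℝ → ℝ}, ContinuousOn f U → ∀ y ∈ uIcc y₁ y₂,
      IntervalIntegrable (fun x => f (x, y)) volume x₁ x₂ := fun hf y hy =>
    (hf.comp (f := fun x => (x, y)) (by fun_prop) fun x hx => hQ ⟨hx, hy⟩).intervalIntegrable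
  have h₀' := h₀ x₁ x₂ y₁ y₂ hQ
  simp only [Pi.zero_apply, intervalIntegral.integral_zero] at h₀'
  calc (∫ y in y₁..y₂, (a (x₂, y) + a₀ (x₂, y) - (a (x₁, y) + a₀ (x₁, y)))) +
        ∫ x in x₁..x₂, (b (x, y₂) + b₀ (x, y₂) - (b (x, y₁) + b₀ (x, y₁)))
    _ = ((∫ y in y₁..y₂, (a (x₂, y) - a (x₁, y))) + ∫ x in x₁..x₂, (b (x, y₂) - b (x, y₁))) +
        ((∫ y in y₁..y₂, (a₀ (x₂, y) - a₀ (x₁, y))) +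
          ∫ x in x₁..x₂, (b₀ (x, y₂) - b₀ (x, y₁))) := by
      simp only [add_sub_add_comm]
      rw [add_add_add_comm,
        intervalIntegral.integral_add ((hx ha _ right_mem_uIcc).sub (hx ha _ left_mem_uIcc))
          ((hx ha₀ _ right_mem_uIcc).sub (hx ha₀ _ left_mem_uIcc)),
        intervalIntegral.integral_add ((hy hb _ right_mem_uIcc).sub (hy hb _ left_mem_uIcc))
          ((hy hb₀ _ right_mem_uIcc).sub (hy hb₀ _ left_mem_uIcc))]
    _ = ∫ x in x₁..x₂, ∫ y in y₁..y₂, K (x, y) := by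
      rw [h x₁ x₂ y₁ y₂ hQ, h₀', add_zero]

lemma hasFluxDensityOn_perp_fderiv {w : ℝ × ℝ → ℝ} {w' : ℝ × ℝ → ℝ × ℝ →L[ℝ] ℝ} {U : Set (ℝ × ℝ)}
    (hw : ∀ q ∈ U, HasFDerivAt w (w' q) q) (hw' : ContinuousOn w' U) :
    HasFluxDensityOn (fun q => w' q (0, 1)) (fun q => -w' q (1, 0)) 0 U := by
  intro x₁ x₂ y₁ y₂ hQ
  have hy : ∀ x ∈ uIcc x₁ x₂, IntervalIntegrable (fun y => w' (x, y) (0, 1)) volume y₁ y₂ ∧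
      ∫ y in y₁..y₂, w' (x, y) (0, 1) = w (x, y₂) - w (x, y₁) := fun x hx => by
    have hi : IntervalIntegrable (fun y => w' (x, y) (0, 1)) volume y₁ y₂ :=
      ((hw'.comp (by fun_prop) fun y hy => hQ ⟨hx, hy⟩).clm_apply
        continuousOn_const).intervalIntegrable
    exact ⟨hi, intervalIntegral.integral_eq_sub_of_hasDerivAt (fun y hy =>
      (hw _ (hQ ⟨hx, hy⟩)).comp_hasDerivAt y ((hasDerivAt_const y x).prodMk (hasDerivAt_id y))) hi⟩
  have hx : ∀ y ∈ uIcc y₁ y₂, IntervalIntegrable (fun x => w' (x, y) (1, 0)) volume x₁ x₂ ∧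
      ∫ x in x₁..x₂, w' (x, y) (1, 0) = w (x₂, y) - w (x₁, y) := fun y hy => by
    have hi : IntervalIntegrable (fun x => w' (x, y) (1, 0)) volume x₁ x₂ :=
      ((hw'.comp (f := fun x => (x, y)) (by fun_prop) fun x hx => hQ ⟨hx, hy⟩).clm_apply
        continuousOn_const).intervalIntegrable
    exact ⟨hi, intervalIntegral.integral_eq_sub_of_hasDerivAt (fun x hx =>
      (hw _ (hQ ⟨hx, hy⟩)).comp_hasDerivAt x ((hasDerivAt_id x).prodMk (hasDerivAt_const x y))) hi⟩
  have hx₁ := hy x₁ left_mem_uIcc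
  have hx₂ := hy x₂ right_mem_uIcc
  have hy₁ := hx y₁ left_mem_uIcc
  have hy₂ := hx y₂ right_mem_uIcc
  simp only [neg_sub_neg, Pi.zero_apply, intervalIntegral.integral_zero]
  rw [intervalIntegral.integral_sub hx₂.1 hx₁.1, intervalIntegral.integral_sub hy₁.1 hy₂.1,
    hx₁.2, hx₂.2, hy₁.2, hy₂.2]
  ring

lemma gradient_apply {u : Plane → ℝ} (p : Plane) (i : Fin 2) :
    gradient u p i = fderiv ℝ u p (EuclideanSpace.single i 1) := by
  rw [← inner_gradient_left, EuclideanSpace.inner_single_right]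
  simp

lemma hasDivergenceOn_perp_gradient_add {u : Plane → ℝ} {F : Plane → Plane} (hΩ : IsOpen Ω)
    (hu : ContDiffOn ℝ 1 u Ω) (hF : ContDiffOn ℝ 1 F Ω) :
    HasDivergenceOn (fun p => perp (gradient u p + F p)) (rot F) Ω := by
  have hT : MapsTo toPlane (toPlane ⁻¹' Ω) Ω := fun q hq => hq
  have hu' : ContinuousOn (fun q => (fderiv ℝ u (toPlane q)).comp (toPlane : ℝ × ℝ →L[ℝ] Plane))
      (toPlane ⁻¹' Ω) :=
    ((hu.continuousOn_fderiv_of_isOpen hΩ le_rfl).comp toPlane.continuous.continuousOn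
      hT).clm_comp continuousOn_const
  have hF' : ∀ (v : Plane) i, ContinuousOn (fun q => fderiv ℝ F (toPlane q) v i) (toPlane ⁻¹' Ω) :=
    fun v i => (EuclideanSpace.proj i : Plane →L[ℝ] ℝ).continuous.comp_continuousOn
      (((hF.continuousOn_fderiv_of_isOpen hΩ le_rfl).comp toPlane.continuous.continuousOn
        hT).clm_apply continuousOn_const)
  have hFd : ∀ i, ∀ q ∈ toPlane ⁻¹' Ω, HasFDerivAt (fun q => F (toPlane q) i)
      ((EuclideanSpace.proj i : Plane →L[ℝ] ℝ).comp
        ((fderiv ℝ F (toPlane q)).comp (toPlane : ℝ × ℝ →L[ℝ] Plane))) q := fun i q hq =>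
    (EuclideanSpace.proj i : Plane →L[ℝ] ℝ).hasFDerivAt.comp q
      (((hF.differentiableOn one_ne_zero).differentiableAt
        (hΩ.mem_nhds hq)).hasFDerivAt.comp q toPlane.hasFDerivAt)
  have hFc : ∀ i, ContinuousOn (fun q => F (toPlane q) i) (toPlane ⁻¹' Ω) := fun i q hq =>
    (hFd i q hq).continuousAt.continuousWithinAt
  have hdu := hasFluxDensityOn_perp_fderiv (fun q hq =>
    ((hu.differentiableOn one_ne_zero).differentiableAt
      (hΩ.mem_nhds (hT hq))).hasFDerivAt.comp q toPlane.hasFDerivAt) hu'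
  have hdF := hasFluxDensityOn_of_hasFDerivAt (hFd 1) (fun q hq => (hFd 0 q hq).neg)
    (K := fun q => rot F (toPlane q)) ((hF' _ 1).sub (hF' _ 0)) fun q _ =>
      (sub_eq_add_neg _ _).symm
  unfold HasDivergenceOn
  convert hdF.add_solenoidal hdu (hFc 1) (hFc 0).neg (hu'.clm_apply continuousOn_const)
    (hu'.clm_apply continuousOn_const).neg using 1 <;> ext q <;>
    simp [perp, gradient_apply, toPlane_one_zero, toPlane_zero_one, add_comm]

lemma HasDivergenceOn.hasIntegratingFactorAt_of_continuous (h : HasDivergenceOn V K U)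
    (hU : U ∈ 𝓝 p) (hV : Continuous V) (hK : Continuous K) (hp : V p ≠ 0) :
    HasIntegratingFactorAt (fun q => InnerProductSpace.toDual ℝ Plane (perp (V q))) V K p := by
  have hp' : V p 0 ≠ 0 ∨ V p 1 ≠ 0 := by
    by_contra! h₀
    exact hp (by ext i; fin_cases i <;> simp [h₀])
  have hT : ∀ q : Plane, toPlane (toPlane.symm q) = q := toPlane.apply_symm_apply
  refine (HasFluxDensityOn.hasIntegratingFactorAt (p := toPlane.symm p) (by fun_prop) (by fun_prop)
    (by fun_prop) h (toPlane.continuous.continuousAt.preimage_mem_nhds (by rwa [hT]))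
    (by simpa only [hT] using hp')).neg.pullback (T := toPlane.symm) (μ := 1)
    (T' := fun _ => (toPlane.symm : Plane →L[ℝ] ℝ × ℝ))
    (.of_forall fun q => toPlane.symm.hasFDerivAt)
    (.of_forall fun q => ?_) (.of_forall fun q => ?_) (.of_forall fun q => ?_)
  · ext v
    simp only [fluxForm, perp, hT, PiLp.inner_apply, RCLike.inner_apply, Real.ringHom_apply,
      InnerProductSpace.toDual_apply_apply, Fin.sum_univ_two, Matrix.cons_val_zero,
      Matrix.cons_val_one, Matrix.cons_val_fin_one, Pi.neg_apply, neg_sub,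
      ContinuousLinearMap.sub_comp, ContinuousLinearMap.smul_comp, sub_apply, smul_apply,
      ContinuousLinearMap.comp_apply, ContinuousLinearEquiv.coe_coe,
      show toPlane.symm v = (v 0, v 1) from rfl, ContinuousLinearMap.coe_fst',
      ContinuousLinearMap.coe_snd', smul_eq_mul]
    ring
  · simp only [hT, Pi.one_apply, one_smul]
    rfl
  · simp [hT]

theorem HasDivergenceOn.hasIntegratingFactorAt (h : HasDivergenceOn V K U) (hU : IsOpen U)
    (hV : ContinuousOn V U) (hK : ContinuousOn K U) (hpU : p ∈ U) (hp : V p ≠ 0) :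
    HasIntegratingFactorAt (fun q => InnerProductSpace.toDual ℝ Plane (perp (V q))) V K p := by
  have hU' : ∀ᶠ q in 𝓝 p, q ∈ U := hU.mem_nhds hpU
  obtain ⟨W, hW, hWV⟩ := exists_continuous_eventuallyEq
    (hU'.mono fun q hq => hV.continuousAt (hU.mem_nhds hq))
  obtain ⟨H, hH, hHK⟩ := exists_continuous_eventuallyEq
    (hU'.mono fun q hq => hK.continuousAt (hU.mem_nhds hq))
  refine ((h.mono_congr (W := W) (H := H) (U := {q ∈ U | W q = V q ∧ H q = K q}) (fun q hq => hq.1)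
    (fun q hq => hq.2.1.symm) fun q hq => hq.2.2.symm).hasIntegratingFactorAt_of_continuous
    (hU'.and (hWV.and hHK)) hW hH (by rwa [hWV.self_of_nhds])).congr ?_ hWV.symm hHK.symm
  exact hWV.mono fun q hq => by simp only [hq]

theorem DivEqWeakly.hasDivergenceOn (h : DivEqWeakly V K Ω) (hΩ : IsOpen Ω)
    (hV : ContinuousOn V Ω) (hK : ContinuousOn K Ω) : HasDivergenceOn V K Ω := by
  intro x₁ x₂ y₁ y₂ hQ
  obtain ⟨δ, hδ, hδΩ⟩ := ((isCompact_uIcc.prod isCompact_uIcc).image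
    toPlane.continuous).exists_cthickening_subset_open hΩ (image_subset_iff.mpr hQ)
  obtain ⟨W, hW, hWV⟩ := exists_continuous_eqOn (hV.mono hδΩ) isClosed_cthickening
  obtain ⟨H, hH, hHK⟩ := exists_continuous_eqOn (hK.mono hδΩ) isClosed_cthickening
  have hthick := thickening_subset_cthickening δ (toPlane '' uIcc x₁ x₂ ×ˢ uIcc y₁ y₂)
  have hWH : HasDivergenceOn W H (thickening δ (toPlane '' uIcc x₁ x₂ ×ˢ uIcc y₁ y₂)) :=
    ((h.mono (hthick.trans hδΩ)).congr isOpen_thickening.measurableSet (hWV.symm.mono hthick)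
      (hHK.symm.mono hthick)).hasDivergenceOn_of_continuous isOpen_thickening hW hH
  exact hWH.mono_congr subset_rfl (hWV.mono hthick) (hHK.mono hthick) x₁ x₂ y₁ y₂
    fun q hq => self_subset_thickening hδ _ (mem_image_of_mem toPlane hq)

end Divergence

section Normals

variable {u H : Plane → ℝ} {F : Plane → Plane} {Ω : Set Plane} {p : Plane}

lemma continuousOn_gradient_add (hΩ : IsOpen Ω) (hu : ContDiffOn ℝ 1 u Ω)
    (hF : ContinuousOn F Ω) : ContinuousOn (fun p => gradient u p + F p) Ω :=
  ((InnerProductSpace.toDual ℝ Plane).symm.continuous.comp_continuousOn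
    (hu.continuousOn_fderiv_of_isOpen hΩ le_rfl)).add hF

lemma continuousOn_rot (hΩ : IsOpen Ω) (hF : ContDiffOn ℝ 1 F Ω) : ContinuousOn (rot F) Ω := by
  have hF' : ∀ (v : Plane) i, ContinuousOn (fun p => fderiv ℝ F p v i) Ω := fun v i =>
    (EuclideanSpace.proj i : Plane →L[ℝ] ℝ).continuous.comp_continuousOn
      ((hF.continuousOn_fderiv_of_isOpen hΩ le_rfl).clm_apply continuousOn_const)
  exact (hF' _ 1).sub (hF' _ 0)

lemma continuous_perp : Continuous perp := by
  unfold perp; fun_prop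

lemma norm_perp (v : Plane) : ‖perp v‖ = ‖v‖ := by
  simp [EuclideanSpace.norm_eq, perp, add_comm]

lemma density_pos (hp : gradient u p + F p ≠ 0) : 0 < density u F p := norm_pos_iff.mpr hp

lemma density_smul_normal (hp : gradient u p + F p ≠ 0) :
    density u F p • normal u F p = gradient u p + F p :=
  smul_inv_smul₀ (density_pos hp).ne' _

lemma norm_normal (hp : gradient u p + F p ≠ 0) : ‖normal u F p‖ = 1 := by
  rw [normal, density, norm_smul, norm_inv, norm_norm, inv_mul_cancel₀ (norm_ne_zero_iff.mpr hp)]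

lemma perp_smul (c : ℝ) (v : Plane) : perp (c • v) = c • perp v := by
  ext i; fin_cases i <;> simp [perp]

lemma perp_perp (v : Plane) : perp (perp v) = -v := by
  ext i; fin_cases i <;> simp [perp]

lemma continuousOn_normal (hΩ : IsOpen Ω) (hu : ContDiffOn ℝ 1 u Ω) (hF : ContinuousOn F Ω)
    (hns : ∀ p ∈ Ω, gradient u p + F p ≠ 0) : ContinuousOn (normal u F) Ω := by
  have h := continuousOn_gradient_add hΩ hu hF
  exact (h.norm.inv₀ fun p hp => (density_pos (hns p hp)).ne').smul h

theorem hasIntegratingFactorAt_normalPerp (hΩ : IsOpen Ω) (hu : ContDiffOn ℝ 1 u Ω)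
    (hF : ContinuousOn F Ω) (hH : ContinuousOn H Ω) (hns : ∀ p ∈ Ω, gradient u p + F p ≠ 0)
    (hdiv : DivEqWeakly (normal u F) H Ω) (hp : p ∈ Ω) :
    HasIntegratingFactorAt (fun q => InnerProductSpace.toDual ℝ Plane (normalPerp u F q))
      (normal u F) H p :=
  have hN := continuousOn_normal hΩ hu hF hns
  (hdiv.hasDivergenceOn hΩ hN hH).hasIntegratingFactorAt hΩ hN hH hp
    (norm_ne_zero_iff.mp (by rw [norm_normal (hns p hp)]; exact one_ne_zero))

theorem hasIntegratingFactorAt_density_smul_normal (hΩ : IsOpen Ω) (hu : ContDiffOn ℝ 1 u Ω)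
    (hF : ContDiffOn ℝ 1 F Ω) (hns : ∀ p ∈ Ω, gradient u p + F p ≠ 0) (hp : p ∈ Ω) :
    HasIntegratingFactorAt
      (fun q => InnerProductSpace.toDual ℝ Plane (density u F q • normal u F q))
      (normalPerp u F) (fun q => rot F q / density u F q) p := by
  have hperp : perp (gradient u p + F p) ≠ 0 := by
    rw [← norm_ne_zero_iff, norm_perp, norm_ne_zero_iff]
    exact hns p hp
  have hU : ∀ᶠ q in 𝓝 p, q ∈ Ω := hΩ.mem_nhds hp
  refine ((hasDivergenceOn_perp_gradient_add hΩ hu hF).hasIntegratingFactorAt hΩ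
    (continuous_perp.comp_continuousOn (continuousOn_gradient_add hΩ hu hF.continuousOn))
    (continuousOn_rot hΩ hF) hp hperp).neg.pullback (T := id) (μ := fun q => (density u F q)⁻¹)
    (.of_forall fun q => hasFDerivAt_id q) ?_ (.of_forall fun q => ?_) (.of_forall fun q => ?_)
  · filter_upwards [hU] with q hq
    rw [density_smul_normal (hns q hq)]
    simp [perp_perp]
  · simp only [ContinuousLinearMap.id_apply, normalPerp, normal, perp_smul, id]
  · simp only [id, div_eq_inv_mul]

end Normals

section Curves

lemma exists_reparametrization {I : Set ℝ} {ψ : ℝ → ℝ} (hI : IsOpen I) (hIc : I.OrdConnected)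
    (hψ : ContinuousOn ψ I) (hψ₀ : ∀ x ∈ I, 0 < ψ x) :
    ∃ (J : Set ℝ) (τ : ℝ → ℝ), IsOpen J ∧ J.OrdConnected ∧ τ '' J = I ∧
      ∀ σ ∈ J, HasDerivAt τ (ψ (τ σ))⁻¹ σ := by
  obtain rfl | ⟨x₀, hx₀⟩ := I.eq_empty_or_nonempty
  · exact ⟨∅, id, by simp [ordConnected_empty]⟩
  set l : ℝ → ℝ := fun x => ∫ ξ in x₀..x, ψ ξ
  have hl : ∀ x ∈ I, HasStrictDerivAt l (ψ x) x := fun x hx =>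
    intervalIntegral.integral_hasStrictDerivAt_right
      (hψ.mono (hIc.uIcc_subset hx₀ hx)).intervalIntegrable
      (hψ.stronglyMeasurableAtFilter hI x hx) (hψ.continuousAt (hI.mem_nhds hx))
  have hlc : ContinuousOn l I := fun x hx => (hl x hx).hasDerivAt.continuousAt.continuousWithinAt
  have hinj : InjOn l I := StrictMonoOn.injOn <|
    strictMonoOn_of_deriv_pos hIc.convex hlc fun x hx => by
      rw [(hl x (interior_subset hx)).hasDerivAt.deriv]
      exact hψ₀ x (interior_subset hx)
  have hτ : LeftInvOn (Function.invFunOn l I) l I := hinj.leftInvOn_invFunOn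
  refine ⟨l '' I, Function.invFunOn l I, isOpen_iff_mem_nhds.mpr ?_,
    (hIc.isPreconnected.image l hlc).ordConnected, hτ.image_image, ?_⟩
  · rintro _ ⟨x, hx, rfl⟩
    rw [← (hl x hx).map_nhds_eq (hψ₀ x hx).ne']
    exact image_mem_map (hI.mem_nhds hx)
  · rintro _ ⟨x, hx, rfl⟩
    rw [hτ hx]
    exact ((hl x hx).to_local_left_inverse (hψ₀ x hx).ne'
      (mem_of_superset (hI.mem_nhds hx) hτ)).hasDerivAt

lemma isIntegralCurveTrace_image {X : Plane → Plane} {c : ℝ → Plane} {I : Set ℝ} {ψ : ℝ → ℝ}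
    (hI : IsOpen I) (hIc : I.OrdConnected) (hI₀ : I.Nonempty) (hψ : ContinuousOn ψ I)
    (hψ₀ : ∀ x ∈ I, 0 < ψ x) (hc : ∀ x ∈ I, HasDerivAt c (ψ x • X (c x)) x) :
    IsIntegralCurveTrace X (c '' I) := by
  obtain ⟨J, τ, hJ, hJc, rfl, hτ⟩ := exists_reparametrization hI hIc hψ hψ₀
  refine ⟨J, c ∘ τ, hJ, hJc, hI₀.of_image, fun σ hσ => ?_, image_comp c τ J⟩
  have h := (hc _ (mem_image_of_mem τ hσ)).scomp σ (hτ σ hσ)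
  rw [smul_smul, inv_mul_cancel₀ (hψ₀ _ (mem_image_of_mem τ hσ)).ne', one_smul] at h
  exact h.hasDerivWithinAt

lemma HasDerivAlongOn.hasDerivAlong {X : Plane → Plane} {h h' : Plane → ℝ} {U W C : Set Plane}
    {p : Plane} (hX : HasDerivAlongOn X h h' W) (hUW : U ⊆ W) (hC : IsIntegralCurveTrace X C)
    (hCU : C ⊆ U) (hp : p ∈ C) : HasDerivAlong X U h (h' p) p := by
  refine ⟨⟨C, hC, hCU, hp⟩, ?_⟩
  rintro I γ hI - hγ hγU σ hσ rfl
  have h := hX γ 1 σ (hUW (hγU hσ)) <| by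
    filter_upwards [hI.mem_nhds hσ] with τ hτ
    simpa only [Pi.one_apply, one_smul] using (hγ τ hτ).hasDerivAt (hI.mem_nhds hτ)
  simpa only [Pi.one_apply, one_mul] using h

end Curves

section Charts

variable {Ψ Φ : Plane → Plane} {U : Set Plane} {p : Plane}

lemma exists_openPartialHomeomorph_contDiffAt_symm {E : Type*} [NormedAddCommGroup E]
    [NormedSpace ℝ E] [FiniteDimensional ℝ E] {Ψ : E → E} {p : E} (hΨ : ContDiffAt ℝ 1 Ψ p)
    (hinj : Function.Injective (fderiv ℝ Ψ p)) :
    ∃ e : OpenPartialHomeomorph E E, ⇑e = Ψ ∧ p ∈ e.source ∧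
      ContDiffAt ℝ 1 e.symm (Ψ p) := by
  have hΨ' : HasFDerivAt Ψ ((LinearEquiv.ofInjectiveEndo (fderiv ℝ Ψ p : E →ₗ[ℝ] E)
      hinj).toContinuousLinearEquiv : E →L[ℝ] E) p :=
    have := FiniteDimensional.complete ℝ E
    (hΨ.differentiableAt one_ne_zero).hasFDerivAt.congr_fderiv (by ext; rfl)
  exact ⟨hΨ.toOpenPartialHomeomorph Ψ hΨ' one_ne_zero, rfl,
    hΨ.mem_toOpenPartialHomeomorph_source hΨ' one_ne_zero, hΨ.to_localInverse hΨ' one_ne_zero⟩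

lemma exists_isC1DiffeoOn (hU : IsOpen U) (hp : p ∈ U) (hΨ : ContDiffOn ℝ 1 Ψ U)
    (hinj : Function.Injective (fderiv ℝ Ψ p)) :
    ∃ (W : Set Plane) (Φ : Plane → Plane), p ∈ W ∧ W ⊆ U ∧ IsC1DiffeoOn Ψ Φ W ∧
      Convex ℝ (Ψ '' W) := by
  obtain ⟨e, rfl, hpe, heC⟩ := exists_openPartialHomeomorph_contDiffAt_symm
    (hΨ.contDiffAt (hU.mem_nhds hp)) hinj
  have hsymm : ∀ᶠ q in 𝓝 (e p), q ∈ e.target ∧ e.symm q ∈ U ∧ ContDiffAt ℝ 1 e.symm q := by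
    refine (e.open_target.eventually_mem (e.map_source hpe)).and
      (.and ?_ (heC.eventually (by simp)))
    exact heC.continuousAt.eventually_mem (by rw [e.left_inv hpe]; exact hU.mem_nhds hp)
  obtain ⟨r, hr, hball⟩ := eventually_nhds_iff_ball.mp hsymm
  choose htarget hsymmU hsymmC using hball
  have himage : e '' (e.symm '' ball (e p) r) = ball (e p) r :=
    (e.rightInvOn.mono htarget).image_image
  have hWU : e.symm '' ball (e p) r ⊆ U := image_subset_iff.mpr hsymmU
  have hinv : LeftInvOn e.symm e (e.symm '' ball (e p) r) := by
    rintro _ ⟨q, hq, rfl⟩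
    rw [e.right_inv (htarget q hq)]
  refine ⟨e.symm '' ball (e p) r, e.symm, ⟨e p, mem_ball_self hr, e.left_inv hpe⟩, hWU,
    ⟨e.symm.isOpen_image_of_subset_source isOpen_ball htarget, ?_, hΨ.mono hWU, ?_, hinv⟩, ?_⟩ <;>
    rw [himage]
  exacts [isOpen_ball, fun q hq => (hsymmC q hq).contDiffWithinAt, convex_ball _ _]

lemma IsC1DiffeoOn.fderiv_fderiv (h : IsC1DiffeoOn Ψ Φ U) (hp : p ∈ U) (v : Plane) :
    fderiv ℝ Φ (Ψ p) (fderiv ℝ Ψ p v) = v := by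
  obtain ⟨hU, hΨU, hΨ, hΦ, hinv⟩ := h
  have hΨ' := ((hΨ.contDiffAt (hU.mem_nhds hp)).differentiableAt one_ne_zero).hasFDerivAt
  have hΦ' := ((hΦ.contDiffAt (hΨU.mem_nhds (mem_image_of_mem Ψ hp))).differentiableAt
    one_ne_zero).hasFDerivAt
  have hid : HasFDerivAt (Φ ∘ Ψ) (ContinuousLinearMap.id ℝ Plane) p :=
    (hasFDerivAt_id p).congr_of_eventuallyEq (mem_of_superset (hU.mem_nhds hp) hinv)
  exact DFunLike.congr_fun ((hΦ'.comp p hΨ').unique hid) v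

lemma levelSet_eq_image_line (hinv : LeftInvOn Φ Ψ U) {i j : Fin 2} (hij : i ≠ j) (a : Plane) :
    {q ∈ U | Ψ q j = a j} = (fun x : ℝ => Φ (a + x • EuclideanSpace.single i 1)) ''
      {x | a + x • EuclideanSpace.single i 1 ∈ Ψ '' U} := by
  ext q
  constructor
  · rintro ⟨hq, hqj⟩
    have hΨq : a + (Ψ q i - a i) • EuclideanSpace.single i 1 = Ψ q := by
      ext k
      obtain rfl | rfl : k = i ∨ k = j := by omega
      · simp
      · simp [hij.symm, hqj]
    exact ⟨Ψ q i - a i, ⟨q, hq, hΨq.symm⟩, by simp only [hΨq, hinv hq]⟩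
  · rintro ⟨x, ⟨q, hq, hΨq⟩, rfl⟩
    simp only [← hΨq, hinv hq]
    exact ⟨hq, by simp [hΨq, hij.symm]⟩

lemma IsC1DiffeoOn.isIntegralCurveTrace_levelSet (h : IsC1DiffeoOn Ψ Φ U)
    (hconv : Convex ℝ (Ψ '' U)) {X : Plane → Plane} {μ : Plane → ℝ} {i j : Fin 2} (hij : i ≠ j)
    (hμ : ContinuousOn μ U) (hμ₀ : ∀ q ∈ U, 0 < μ q)
    (hX : ∀ q ∈ U, fderiv ℝ Ψ q (X q) = μ q • EuclideanSpace.single i 1) (hp : p ∈ U) :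
    IsIntegralCurveTrace X {q ∈ U | Ψ q j = Ψ p j} := by
  have hΦ' : ∀ q ∈ U, fderiv ℝ Φ (Ψ q) (EuclideanSpace.single i 1) = (μ q)⁻¹ • X q := fun q hq => by
    rw [eq_inv_smul_iff₀ (hμ₀ q hq).ne', ← map_smul, ← hX q hq, h.fderiv_fderiv hq]
  obtain ⟨-, hΨU, -, hΦ, hinv⟩ := h
  set ℓ : ℝ → Plane := fun x => Ψ p + x • EuclideanSpace.single i 1
  have hℓ : ∀ x, HasDerivAt ℓ (EuclideanSpace.single i 1) x := fun x =>
    (((hasDerivAt_id x).smul_const _).const_add (Ψ p)).congr_deriv (one_smul ℝ _)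
  have hℓc : Continuous ℓ := by fun_prop
  have hΦU : ∀ r ∈ Ψ '' U, Φ r ∈ U ∧ Ψ (Φ r) = r := by
    rintro _ ⟨q, hq, rfl⟩
    rw [hinv hq]
    exact ⟨hq, rfl⟩
  have hIc : Convex ℝ (ℓ ⁻¹' (Ψ '' U)) := (hconv.translate_preimage_right (Ψ p)).linear_preimage
    (LinearMap.toSpanSingleton ℝ Plane (EuclideanSpace.single i 1))
  have hψ : ContinuousOn (fun x => (μ (Φ (ℓ x)))⁻¹) (ℓ ⁻¹' (Ψ '' U)) :=
    (hμ.comp (hΦ.continuousOn.comp hℓc.continuousOn fun x hx => hx)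
      fun x hx => (hΦU _ hx).1).inv₀ fun x hx => (hμ₀ _ (hΦU _ hx).1).ne'
  rw [levelSet_eq_image_line hinv hij]
  refine isIntegralCurveTrace_image (hΨU.preimage hℓc) hIc.ordConnected ⟨0, p, hp, by simp⟩ hψ
    (fun x hx => inv_pos.mpr (hμ₀ _ (hΦU _ hx).1)) fun x hx => ?_
  have hΦx := ((hΦ.contDiffAt (hΨU.mem_nhds hx)).differentiableAt
    one_ne_zero).hasFDerivAt.comp_hasDerivAt x (hℓ x)
  refine hΦx.congr_deriv ?_
  rw [← hΦ' _ (hΦU _ hx).1, (hΦU _ hx).2]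

end Charts

section AdaptedCoordinates

variable {n : Plane → Plane} {s t f k : Plane → ℝ} {U : Set Plane} {p : Plane}

lemma inner_perp_mul_add_inner_mul {m : Plane} (hm : ‖m‖ = 1) (v w : Plane) :
    inner ℝ (perp m) v * inner ℝ (perp m) w + inner ℝ m v * inner ℝ m w = inner ℝ v w := by
  have hm' : m 0 ^ 2 + m 1 ^ 2 = 1 := by
    simpa [hm, Fin.sum_univ_two] using (EuclideanSpace.real_norm_sq_eq m).symm
  simp only [PiLp.inner_apply, Fin.sum_univ_two, RCLike.inner_apply, conj_trivial, perp,
    Matrix.cons_val_zero, Matrix.cons_val_one, Matrix.cons_val_fin_one, mul_neg]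
  linear_combination (v 0 * w 0 + v 1 * w 1) * hm'

lemma inner_perp_self (v : Plane) : inner ℝ v (perp v) = 0 := by
  simp [PiLp.inner_apply, Fin.sum_univ_two, perp, mul_comm]

lemma contDiffOn_one_of_hasGradientAt {E : Type*} [NormedAddCommGroup E] [InnerProductSpace ℝ E]
    [CompleteSpace E] {h : E → ℝ} {G : E → E} {W : Set E} (hW : IsOpen W) (hG : ContinuousOn G W)
    (hh : ∀ q ∈ W, HasGradientAt h (G q) q) : ContDiffOn ℝ 1 h W := by
  refine (contDiffOn_succ_iff_fderiv_of_isOpen (n := 0) hW).mpr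
    ⟨fun q hq => (hh q hq).differentiableAt.differentiableWithinAt, by simp, contDiffOn_zero.mpr ?_⟩
  exact ((InnerProductSpace.toDual ℝ E).continuous.comp_continuousOn hG).congr fun q hq =>
    (hh q hq).hasFDerivAt.fderiv

/-- `(s, t)` are coordinates adapted to the orthonormal frame `(n^⊥, n)` on `U`: the gradients of
`s` and `t` are the frame vectors scaled by the positive functions `f` and `k`. -/
structure IsAdaptedCoordinates (n : Plane → Plane) (s t f k : Plane → ℝ) (U : Set Plane) :
    Prop where
  continuousOn_normal : ContinuousOn n U
  norm_eq_one : ∀ p ∈ U, ‖n p‖ = 1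
  continuousOn_scale_fst : ContinuousOn f U
  continuousOn_scale_snd : ContinuousOn k U
  scale_fst_pos : ∀ p ∈ U, 0 < f p
  scale_snd_pos : ∀ p ∈ U, 0 < k p
  hasGradientAt_fst : ∀ p ∈ U, HasGradientAt s (f p • perp (n p)) p
  hasGradientAt_snd : ∀ p ∈ U, HasGradientAt t (k p • n p) p

namespace IsAdaptedCoordinates

lemma mono {W : Set Plane} (h : IsAdaptedCoordinates n s t f k U) (hW : W ⊆ U) :
    IsAdaptedCoordinates n s t f k W := by
  obtain ⟨hn, hn₁, hf, hk, hf₀, hk₀, hs, ht⟩ := h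
  exact ⟨hn.mono hW, fun p hp => hn₁ p (hW hp), hf.mono hW, hk.mono hW, fun p hp => hf₀ p (hW hp),
    fun p hp => hk₀ p (hW hp), fun p hp => hs p (hW hp), fun p hp => ht p (hW hp)⟩

lemma contDiffOn_fst (h : IsAdaptedCoordinates n s t f k U) (hU : IsOpen U) : ContDiffOn ℝ 1 s U :=
  contDiffOn_one_of_hasGradientAt hU
    (h.continuousOn_scale_fst.smul (continuous_perp.comp_continuousOn h.continuousOn_normal))
    h.hasGradientAt_fst

lemma contDiffOn_snd (h : IsAdaptedCoordinates n s t f k U) (hU : IsOpen U) : ContDiffOn ℝ 1 t U :=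
  contDiffOn_one_of_hasGradientAt hU (h.continuousOn_scale_snd.smul h.continuousOn_normal)
    h.hasGradientAt_snd

lemma contDiffOn (h : IsAdaptedCoordinates n s t f k U) (hU : IsOpen U) :
    ContDiffOn ℝ 1 (fun p => (!₂[s p, t p] : Plane)) U :=
  toPlane.contDiff.comp_contDiffOn ((h.contDiffOn_fst hU).prodMk (h.contDiffOn_snd hU))

lemma fderiv_apply (h : IsAdaptedCoordinates n s t f k U) (hp : p ∈ U) (v : Plane) :
    fderiv ℝ (fun p => (!₂[s p, t p] : Plane)) p v =
      !₂[f p * inner ℝ (perp (n p)) v, k p * inner ℝ (n p) v] := by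
  have hd : HasFDerivAt (fun p => (!₂[s p, t p] : Plane)) _ p := toPlane.hasFDerivAt.comp p
    ((h.hasGradientAt_fst p hp).hasFDerivAt.prodMk (h.hasGradientAt_snd p hp).hasFDerivAt)
  rw [hd.fderiv, ← real_inner_smul_left, ← real_inner_smul_left]
  rfl

lemma fderiv_perp (h : IsAdaptedCoordinates n s t f k U) (hp : p ∈ U) :
    fderiv ℝ (fun p => (!₂[s p, t p] : Plane)) p (perp (n p)) =
      f p • EuclideanSpace.single 0 1 := by
  rw [h.fderiv_apply hp, inner_perp_self, real_inner_self_eq_norm_sq, norm_perp, h.norm_eq_one p hp]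
  ext i; fin_cases i <;> simp

lemma fderiv_normal (h : IsAdaptedCoordinates n s t f k U) (hp : p ∈ U) :
    fderiv ℝ (fun p => (!₂[s p, t p] : Plane)) p (n p) = k p • EuclideanSpace.single 1 1 := by
  rw [h.fderiv_apply hp, real_inner_comm, inner_perp_self, real_inner_self_eq_norm_sq,
    h.norm_eq_one p hp]
  ext i; fin_cases i <;> simp

lemma pullbackMetric_eq (h : IsAdaptedCoordinates n s t f k U) (hp : p ∈ U) {a b : Plane → ℝ}
    (ha : a !₂[s p, t p] = 1 / f p ^ 2) (hb : b !₂[s p, t p] = 1 / k p ^ 2) :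
    pullbackMetric (fun p => !₂[s p, t p]) (diagMetric a b) p = euclMetric p := by
  have hf := (h.scale_fst_pos p hp).ne'
  have hk := (h.scale_snd_pos p hp).ne'
  refine LinearMap.ext₂ fun v w => ?_
  have heucl : euclMetric p v w = inner ℝ v w := by
    simp [euclMetric, diagMetric, coordDiff, PiLp.inner_apply, mul_comm]
  rw [heucl, ← inner_perp_mul_add_inner_mul (h.norm_eq_one p hp)]
  simp only [pullbackMetric, diagMetric, coordDiff, ha, hb, LinearMap.BilinForm.comp_apply,
    ContinuousLinearMap.coe_coe, h.fderiv_apply hp, LinearMap.add_apply, LinearMap.smul_apply,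
    LinearMap.BilinForm.linMulLin_apply, smul_eq_mul, one_div, PiLp.proj_apply,
    Matrix.cons_val_zero, Matrix.cons_val_one, Matrix.cons_val_fin_one]
  field_simp

lemma injective_fderiv (h : IsAdaptedCoordinates n s t f k U) (hp : p ∈ U) :
    Function.Injective (fderiv ℝ (fun p => (!₂[s p, t p] : Plane)) p) := by
  refine (injective_iff_map_eq_zero _).mpr fun v hv => ?_
  rw [h.fderiv_apply hp] at hv
  have hv₀ : inner ℝ (perp (n p)) v = 0 := by
    simpa [(h.scale_fst_pos p hp).ne'] using congr(($hv : Plane) 0)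
  have hv₁ : inner ℝ (n p) v = 0 := by
    simpa [(h.scale_snd_pos p hp).ne'] using congr(($hv : Plane) 1)
  rw [← inner_self_eq_zero (𝕜 := ℝ), ← inner_perp_mul_add_inner_mul (h.norm_eq_one p hp), hv₀, hv₁,
    mul_zero, add_zero]

lemma exists_chart (h : IsAdaptedCoordinates n s t f k U) (hU : IsOpen U) (hp : p ∈ U) :
    ∃ (W : Set Plane) (Φ : Plane → Plane), p ∈ W ∧ W ⊆ U ∧
      IsC1DiffeoOn (fun q => !₂[s q, t q]) Φ W ∧
      (∀ q ∈ W, IsIntegralCurveTrace (fun q => perp (n q)) {r ∈ W | t r = t q}) ∧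
      ∀ q ∈ W, IsIntegralCurveTrace n {r ∈ W | s r = s q} := by
  obtain ⟨W, Φ, hpW, hWU, hΨ, hconv⟩ :=
    exists_isC1DiffeoOn hU hp (h.contDiffOn hU) (h.injective_fderiv hp)
  have hW := h.mono hWU
  exact ⟨W, Φ, hpW, hWU, hΨ,
    fun q hq => hΨ.isIntegralCurveTrace_levelSet hconv zero_ne_one hW.continuousOn_scale_fst
      hW.scale_fst_pos (fun r hr => hW.fderiv_perp hr) hq,
    fun q hq => hΨ.isIntegralCurveTrace_levelSet hconv one_ne_zero hW.continuousOn_scale_snd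
      hW.scale_snd_pos (fun r hr => hW.fderiv_normal hr) hq⟩

end IsAdaptedCoordinates

theorem exists_isAdaptedCoordinates {u : Plane → ℝ} {F : Plane → Plane} {H : Plane → ℝ}
    {Ω : Set Plane} (hΩ : IsOpen Ω) (hu : ContDiffOn ℝ 1 u Ω) (hF : ContDiffOn ℝ 1 F Ω)
    (hH : ContinuousOn H Ω) (hns : ∀ q ∈ Ω, gradient u q + F q ≠ 0)
    (hdiv : DivEqWeakly (normal u F) H Ω) (hp : p ∈ Ω) :
    ∃ (U : Set Plane) (s t f g : Plane → ℝ), IsOpen U ∧ p ∈ U ∧ U ⊆ Ω ∧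
      ContinuousOn g U ∧ (∀ q ∈ U, 0 < g q) ∧
      IsAdaptedCoordinates (normal u F) s t f (fun q => g q * density u F q) U ∧
      HasDerivAlongOn (normal u F) f (fun q => -(f q * H q)) U ∧
      HasDerivAlongOn (normalPerp u F) g (fun q => -(g q * (rot F q / density u F q))) U := by
  obtain ⟨U₁, s, f, hU₁, hp₁, hf, hf₀, hs, hfN⟩ :=
    hasIntegratingFactorAt_normalPerp hΩ hu hF.continuousOn hH hns hdiv hp
  obtain ⟨U₂, t, g, hU₂, hp₂, hg, hg₀, ht, hgN⟩ :=
    hasIntegratingFactorAt_density_smul_normal hΩ hu hF hns hp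
  have hN := continuousOn_normal hΩ hu hF.continuousOn hns
  have hD := (continuousOn_gradient_add hΩ hu hF.continuousOn).norm
  refine ⟨Ω ∩ (U₁ ∩ U₂), s, t, f, g, hΩ.inter (hU₁.inter hU₂), ⟨hp, hp₁, hp₂⟩, inter_subset_left,
    hg.mono fun q hq => hq.2.2, fun q hq => hg₀ q hq.2.2,
    ⟨hN.mono inter_subset_left, fun q hq => norm_normal (hns q hq.1), hf.mono fun q hq => hq.2.1,
      (hg.mono fun q hq => hq.2.2).mul (hD.mono inter_subset_left), fun q hq => hf₀ q hq.2.1,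
      fun q hq => mul_pos (hg₀ q hq.2.2) (density_pos (hns q hq.1)), fun q hq => ?_,
      fun q hq => ?_⟩, fun γ c σ hσ => hfN γ c σ hσ.2.1, fun γ c σ hσ => hgN γ c σ hσ.2.2⟩
  · exact (hs q hq.2.1).congr_fderiv (map_smul _ _ _).symm
  · exact (ht q hq.2.2).congr_fderiv (by rw [mul_smul, map_smul])

end AdaptedCoordinates

end PMean

end

theorem theoremC_general (Ω : Set PMean.Plane) (hΩo : IsOpen Ω)
    (u : PMean.Plane → ℝ) (F : PMean.Plane → PMean.Plane) (H : PMean.Plane → ℝ)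
    (hu : ContDiffOn ℝ 1 u Ω) (hF : ContDiffOn ℝ 1 F Ω) (hH : ContinuousOn H Ω)
    (hns : PMean.singularSet u F Ω = ∅)
    (hsol : PMean.DivEqWeakly (PMean.normal u F) H Ω)
    (p₀ : PMean.Plane) (hp₀ : p₀ ∈ Ω) :
    ∃ (Ω' : Set PMean.Plane) (s t f g : PMean.Plane → ℝ),
      IsOpen Ω' ∧ p₀ ∈ Ω' ∧ Ω' ⊆ Ω ∧
      ContDiffOn ℝ 1 s Ω' ∧ ContDiffOn ℝ 1 t Ω' ∧
      (∀ p ∈ Ω', PMean.IsIntegralCurveTrace (PMean.normalPerp u F) {q ∈ Ω' | t q = t p}) ∧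
      (∀ p ∈ Ω', PMean.IsIntegralCurveTrace (PMean.normal u F) {q ∈ Ω' | s q = s p}) ∧
      ContinuousOn f Ω' ∧ ContinuousOn g Ω' ∧
      (∀ p ∈ Ω', 0 < f p) ∧ (∀ p ∈ Ω', 0 < g p) ∧
      (∀ p ∈ Ω', HasGradientAt s (f p • PMean.normalPerp u F p) p) ∧
      (∀ p ∈ Ω', HasGradientAt t ((g p * PMean.density u F p) • PMean.normal u F p) p) ∧
      (∃ Nf Ng : PMean.Plane → ℝ,
        ContinuousOn Nf Ω' ∧ ContinuousOn Ng Ω' ∧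
        (∀ p ∈ Ω', PMean.HasDerivAlong (PMean.normal u F) Ω' f (Nf p) p) ∧
        (∀ p ∈ Ω', PMean.HasDerivAlong (PMean.normalPerp u F) Ω' g (Ng p) p) ∧
        (∀ p ∈ Ω', Nf p + f p * H p = 0) ∧
        (∀ p ∈ Ω', Ng p + PMean.rot F p * g p / PMean.density u F p = 0)) ∧
      (∃ (Ω'' : Set PMean.Plane) (Φ : PMean.Plane → PMean.Plane),
        p₀ ∈ Ω'' ∧ Ω'' ⊆ Ω' ∧
        PMean.IsC1DiffeoOn (fun p => !₂[s p, t p]) Φ Ω'' ∧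
        ∀ p ∈ Ω'',
          PMean.pullbackMetric (fun p => !₂[s p, t p])
            (PMean.diagMetric (fun q => 1 / f (Φ q) ^ 2)
              (fun q => 1 / (g (Φ q) ^ 2 * PMean.density u F (Φ q) ^ 2))) p
            = PMean.euclMetric p) := by
  have hns' : ∀ p ∈ Ω, gradient u p + F p ≠ 0 := fun p hp h => hns.subset ⟨hp, h⟩
  obtain ⟨U, s, t, f, g, hU, hpU, hUΩ, hg, hg₀, hst, hfN, hgN⟩ :=
    PMean.exists_isAdaptedCoordinates hΩo hu hF hH hns' hsol hp₀
  obtain ⟨Ω', Φ, hp₀', hΩ'U, hΨ, hchar, hseed⟩ := hst.exists_chart hU hpU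
  have hΩ'Ω := hΩ'U.trans hUΩ
  have hst' := hst.mono hΩ'U
  have hrot : ContinuousOn (fun p => PMean.rot F p / PMean.density u F p) Ω' :=
    ((PMean.continuousOn_rot hΩo hF).div
      (PMean.continuousOn_gradient_add hΩo hu hF.continuousOn).norm fun p hp =>
        (PMean.density_pos (hns' p hp)).ne').mono hΩ'Ω
  refine ⟨Ω', s, t, f, g, hΨ.1, hp₀', hΩ'Ω, hst'.contDiffOn_fst hΨ.1, hst'.contDiffOn_snd hΨ.1,
    hchar, hseed, hst'.continuousOn_scale_fst, hg.mono hΩ'U, hst'.scale_fst_pos,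
    fun p hp => hg₀ p (hΩ'U hp), hst'.hasGradientAt_fst, hst'.hasGradientAt_snd,
    ⟨fun p => -(f p * H p), fun p => -(g p * (PMean.rot F p / PMean.density u F p)),
      (hst'.continuousOn_scale_fst.mul (hH.mono hΩ'Ω)).neg, ((hg.mono hΩ'U).mul hrot).neg,
      fun p hp => hfN.hasDerivAlong hΩ'U (hseed p hp) (sep_subset _ _) ⟨hp, rfl⟩,
      fun p hp => hgN.hasDerivAlong hΩ'U (hchar p hp) (sep_subset _ _) ⟨hp, rfl⟩,
      fun p _ => neg_add_cancel _, fun p _ => by ring⟩,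
    Ω', Φ, hp₀', subset_rfl, hΨ, fun p hp => hst'.pullbackMetric_eq hp ?_ ?_⟩
  all_goals simp only [hΨ.2.2.2.2 hp, mul_pow]

theorem theoremC (Ω : Set PMean.Plane) (hΩo : IsOpen Ω) (hΩc : IsConnected Ω)
    (u : PMean.Plane → ℝ) (F : PMean.Plane → PMean.Plane) (H : PMean.Plane → ℝ)
    (hu : ContDiffOn ℝ 1 u Ω) (hF : ContDiffOn ℝ 1 F Ω) (hH : ContinuousOn H Ω)
    (hns : PMean.singularSet u F Ω = ∅)
    (hsol : PMean.DivEqWeakly (PMean.normal u F) H Ω)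
    (p₀ : PMean.Plane) (hp₀ : p₀ ∈ Ω) :
    ∃ (Ω' : Set PMean.Plane) (s t f g : PMean.Plane → ℝ),
      IsOpen Ω' ∧ p₀ ∈ Ω' ∧ Ω' ⊆ Ω ∧
      ContDiffOn ℝ 1 s Ω' ∧ ContDiffOn ℝ 1 t Ω' ∧
      -- level sets of `t` are characteristic curves, level sets of `s` are seed curves
      (∀ p ∈ Ω', PMean.IsIntegralCurveTrace (PMean.normalPerp u F) {q ∈ Ω' | t q = t p}) ∧
      (∀ p ∈ Ω', PMean.IsIntegralCurveTrace (PMean.normal u F) {q ∈ Ω' | s q = s p}) ∧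
      ContinuousOn f Ω' ∧ ContinuousOn g Ω' ∧
      (∀ p ∈ Ω', 0 < f p) ∧ (∀ p ∈ Ω', 0 < g p) ∧
      -- `∇s = f N^⊥` and `∇t = g D N`
      (∀ p ∈ Ω', HasGradientAt s (f p • PMean.normalPerp u F p) p) ∧
      (∀ p ∈ Ω', HasGradientAt t ((g p * PMean.density u F p) • PMean.normal u F p) p) ∧
      -- `N f` and `N^⊥ g` exist, are continuous and satisfy the two equations
      (∃ Nf Ng : PMean.Plane → ℝ,
        ContinuousOn Nf Ω' ∧ ContinuousOn Ng Ω' ∧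
        (∀ p ∈ Ω', PMean.HasDerivAlong (PMean.normal u F) Ω' f (Nf p) p) ∧
        (∀ p ∈ Ω', PMean.HasDerivAlong (PMean.normalPerp u F) Ω' g (Ng p) p) ∧
        (∀ p ∈ Ω', Nf p + f p * H p = 0) ∧
        (∀ p ∈ Ω', Ng p + PMean.rot F p * g p / PMean.density u F p = 0)) ∧
      -- `(s, t)` is a `C¹` diffeomorphism near `p₀`, with the stated pullback metric
      (∃ (Ω'' : Set PMean.Plane) (Φ : PMean.Plane → PMean.Plane),
        p₀ ∈ Ω'' ∧ Ω'' ⊆ Ω' ∧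
        PMean.IsC1DiffeoOn (fun p => !₂[s p, t p]) Φ Ω'' ∧
        ∀ p ∈ Ω'',
          PMean.pullbackMetric (fun p => !₂[s p, t p])
            (PMean.diagMetric (fun q => 1 / f (Φ q) ^ 2)
              (fun q => 1 / (g (Φ q) ^ 2 * PMean.density u F (Φ q) ^ 2))) p
            = PMean.euclMetric p) :=
  theoremC_general Ω hΩo u F H hu hF hH hns hsol p₀ hp₀
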